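/- Setting. Let $\mathcal S,\mathcal A$ be measurable spaces. Consider a Markov decision process with a Markov kernel $P(dr,ds'\mid s,a)$ (the joint law of reward and next state), an initial law $\rho_0$ on $\mathcal S$ and a discount factor $\gamma\in[0,1)$; let $\lambda\in[0,1]$. Let $\pi_\theta(a\mid s)$, $\theta\in\mathbb R^d$, be a family of policies given by probability densities, jointly measurable in $(s,a)$, with respect to a $\sigma$-finite measure $\nu$ on $\mathcal A$. Fix $\theta$, write $\pi=\pi_\theta$ and $u_\theta(s,a)=\nabla_\theta\log\pi_\theta(a\mid s)$ (assumed measurable), and assume that for each $s$ there are $g_s\in L^1(\nu)$ and $\varepsilon_s>0$ such that, for $\nu$-almost every $a$, $\theta'\mapsto\pi_{\theta'}(a\mid s)$ is differentiable at $\theta$ and $|\pi_{\theta'}(a\mid s)-\pi_\theta(a\mid s)|\le g_s(a)\|\theta'-\theta\|$ for $\|\theta'-\theta\|<\varepsilon_s$. Let $(s_0,a_0,r_0,s_1,a_1,r_1,\dots)$ be the trajectory with $s_0\sim\rho_0$, $a_k\sim\pi(\cdot\mid s_k)$, $(r_k,s_{k+1})\sim P(\cdot\mid s_k,a_k)$,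 and let $$Q^\pi(s,a)=\mathbb E\Bigl[\sum_{k\ge0}\gamma^kr_k\,\Big|\,s_0=s,a_0=a\Bigr],\qquad V^\pi(s)=\mathbb E\Bigl[\sum_{k\ge0}\gamma^kr_k\,\Big|\,s_0=s\Bigr],$$ where $\mathbb E[\sum_k\gamma^k|r_k|\mid s_0=s,a_0=a]$ and $\mathbb E[\sum_k\gamma^k|r_k|\mid s_0=s]$ are assumed finite for all $s,a$. Let $\Psi$ be either $Q^\pi$ or $V^\pi$, let $b:\mathcal S\to\mathbb R$ be any measurable function (a state-dependent baseline), and write $\Psi_k=\Psi(s_k,a_k)$ (respectively $\Psi(s_k)$), $\delta_k=r_k+\gamma\Psi_{k+1}-b(s_k)$, $z_k=\Psi_k-b(s_k)$. For a time $t\ge0$ set $$A_t^{\mathrm{UAE}}=\delta_t+\sum_{l\ge1}(\gamma\lambda)^l(\delta_{t+l}-z_{t+l}),\qquad A_t^{\mathrm{GAE}}=\sum_{l\ge0}(\gamma\lambda)^l\bigl(r_{t+l}+\gamma V^\pi(s_{t+l+1})-V^\pi(s_{t+l})\bigr).$$ Write $u=u_\theta(s_t,a_t)$ and assume finite second moments: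 $\sup_{k\ge0}\mathbb E[\|u\|^2r_{t+k}^2]<\infty$, $\mathbb E[\|u\|^2b(s_t)^2]<\infty$ and $\mathbb E[\|u\|^2V^\pi(s_t)^2]<\infty$. For a random vector $X$ put $\mathbb V[X]=\mathbb E\|X-\mathbb E X\|_2^2$, the expectation being over the whole trajectory. Theorem. The random vectors $uA_t^{\mathrm{UAE}}$ and $uA_t^{\mathrm{GAE}}$ are square integrable (almost surely on $\{u\neq0\}$ the two series converge absolutely), both expectations on the right-hand side below exist (almost surely on $\{u\ne0\}$ the inner conditional expectations are finite and their series converges), and $$\mathbb V\bigl[uA_t^{\mathrm{UAE}}\bigr]-\mathbb V\bigl[uA_t^{\mathrm{GAE}}\bigr]=\underbrace{\mathbb E\Bigl[u^\top u\sum_{l=0}^\infty(\gamma\lambda)^{2l}\gamma^2(1-\lambda^2)\,\mathbb E\bigl[(\Psi_{t+l+1}-V^\pi(s_{t+l+1}))^2\,\big|\,s_t,a_t\bigr]\Bigr]}_{\text{irreducible}}+\underbrace{\mathbb E\Bigl[u^\top u\bigl(b(s_t)^2-V^\pi(s_t)^2-2Q^\pi(s_t,a_t)(b(s_t)-V^\pi(s_t))\bigr)\Bigr]}_{\text{reducible}}.$$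 -/

import Mathlib

open MeasureTheory ProbabilityTheory
open scoped ENNReal NNReal

noncomputable section

namespace UAE

variable {S A : Type*} [MeasurableSpace S] [MeasurableSpace A]

/-! ### Trajectories of a Markov decision process

A trajectory is a sequence of records `((ρ, s), a)`: the `n`-th record holds the state `s_n`, the
action `a_n`, and the reward `ρ = r_{n-1}` that was emitted on the way to `s_n`. The reward slot of
the record number `0` is a dummy. -/

/-- The space of trajectories. -/
abbrev Traj (S A : Type*) : Type _ := ℕ → (ℝ × S) × A

/-- The state `s_t`. -/
def st (ω : Traj S A) (t : ℕ) : S := (ω t).1.2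

/-- The action `a_t`. -/
def act (ω : Traj S A) (t : ℕ) : A := (ω t).2

/-- The reward `r_t`, emitted in response to `(s_t, a_t)`. -/
def rew (ω : Traj S A) (t : ℕ) : ℝ := (ω (t + 1)).1.1

/-- One step of the controlled chain: from `(s, a)` draw the reward and the next state
`(r, s') ∼ P(· | s, a)`, then the next action `a' ∼ π(· | s')`. -/
def stepKernel (P : Kernel (S × A) (ℝ × S)) (π : Kernel S A) :
    Kernel (S × A) ((ℝ × S) × A) :=
  P ⊗ₖ (π.comap (fun x : (S × A) × (ℝ × S) => x.2.2) (by fun_prop))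

instance (P : Kernel (S × A) (ℝ × S)) [IsMarkovKernel P] (π : Kernel S A) [IsMarkovKernel π] :
    IsMarkovKernel (stepKernel P π) := by
  unfold stepKernel; infer_instance

/-- The Markov step as a kernel on histories: only the last state and action matter. -/
def histKernel (P : Kernel (S × A) (ℝ × S)) (π : Kernel S A) (n : ℕ) :
    Kernel (Π _ : Finset.Iic n, (ℝ × S) × A) ((ℝ × S) × A) :=
  (stepKernel P π).comap
    (fun h => ((h ⟨n, Finset.mem_Iic.2 le_rfl⟩).1.2, (h ⟨n, Finset.mem_Iic.2 le_rfl⟩).2))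
    (by fun_prop)

instance (P : Kernel (S × A) (ℝ × S)) [IsMarkovKernel P] (π : Kernel S A) [IsMarkovKernel π]
    (n : ℕ) : IsMarkovKernel (histKernel P π n) := by
  unfold histKernel; infer_instance

/-- The law of the trajectory given `s_0 = s`, `a_0 = a`. -/
def trajSA (P : Kernel (S × A) (ℝ × S)) [IsMarkovKernel P] (π : Kernel S A) [IsMarkovKernel π] :
    Kernel (S × A) (Traj S A) :=
  (Kernel.traj (X := fun _ => (ℝ × S) × A) (histKernel P π) 0).comap
    (fun x _ => (((0 : ℝ), x.1), x.2)) (by fun_prop)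

/-- The law of the trajectory given `s_0 = s`, with `a_0 ∼ π(· | s)`. -/
def trajS (P : Kernel (S × A) (ℝ × S)) [IsMarkovKernel P] (π : Kernel S A) [IsMarkovKernel π] :
    Kernel S (Traj S A) :=
  trajSA P π ∘ₖ (Kernel.id ×ₖ π)

/-- The law of the trajectory with `s_0 ∼ ρ₀`. -/
def trajLaw (P : Kernel (S × A) (ℝ × S)) [IsMarkovKernel P] (π : Kernel S A) [IsMarkovKernel π]
    (ρ₀ : Measure S) : Measure (Traj S A) :=
  trajS P π ∘ₘ ρ₀

/-! ### Value functions -/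

/-- The discounted return `∑ γ^k r_k`. -/
def ret (γ : ℝ) (ω : Traj S A) : ℝ := ∑' k, γ ^ k * rew ω k

/-- The absolute discounted return `∑ γ^k |r_k|`, with values in `[0, ∞]`. -/
def absRet (γ : ℝ) (ω : Traj S A) : ℝ≥0∞ := ∑' k, ‖γ ^ k * rew ω k‖ₑ

/-- The action value function `Q^π(s, a)`. -/
def Qval (P : Kernel (S × A) (ℝ × S)) [IsMarkovKernel P] (π : Kernel S A) [IsMarkovKernel π]
    (γ : ℝ) (s : S) (a : A) : ℝ := ∫ ω, ret γ ω ∂(trajSA P π (s, a))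

/-- The state value function `V^π(s)`. -/
def Vval (P : Kernel (S × A) (ℝ × S)) [IsMarkovKernel P] (π : Kernel S A) [IsMarkovKernel π]
    (γ : ℝ) (s : S) : ℝ := ∫ ω, ret γ ω ∂(trajS P π s)

/-! ### Advantage estimators -/

/-- The residual `δ_t = r_t + γ Ψ_{t+1} - b(s_t)`. -/
def resid (γ : ℝ) (Ψ : S → A → ℝ) (b : S → ℝ) (ω : Traj S A) (t : ℕ) : ℝ :=
  rew ω t + γ * Ψ (st ω (t + 1)) (act ω (t + 1)) - b (st ω t)

/-- The correction `z_t = Ψ_t - b(s_t)`. -/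
def corr (Ψ : S → A → ℝ) (b : S → ℝ) (ω : Traj S A) (t : ℕ) : ℝ :=
  Ψ (st ω t) (act ω t) - b (st ω t)

/-- The `l`-th term, `l ≥ 1`, of the series in the unified advantage estimator. -/
def uaeTerm (γ lam : ℝ) (Ψ : S → A → ℝ) (b : S → ℝ) (t : ℕ) (ω : Traj S A) (l : ℕ) : ℝ :=
  (γ * lam) ^ l * (resid γ Ψ b ω (t + l) - corr Ψ b ω (t + l))

/-- The unified advantage estimator `δ_t + ∑_{l ≥ 1} (γλ)^l (δ_{t+l} - z_{t+l})`. -/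
def uae (γ lam : ℝ) (Ψ : S → A → ℝ) (b : S → ℝ) (t : ℕ) (ω : Traj S A) : ℝ :=
  resid γ Ψ b ω t + ∑' l, uaeTerm γ lam Ψ b t ω (l + 1)

/-- The `l`-th term, `l ≥ 0`, of the generalized advantage estimator:
`(γλ)^l (r_{t+l} + γ V(s_{t+l+1}) - V(s_{t+l}))`. -/
def gaeTerm (γ lam : ℝ) (V : S → ℝ) (t : ℕ) (ω : Traj S A) (l : ℕ) : ℝ :=
  (γ * lam) ^ l * (rew ω (t + l) + γ * V (st ω (t + l + 1)) - V (st ω (t + l)))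

/-- The generalized advantage estimator. -/
def gae (γ lam : ℝ) (V : S → ℝ) (t : ℕ) (ω : Traj S A) : ℝ := ∑' l, gaeTerm γ lam V t ω l

/-- The variance `E ‖X - E X‖²` of a random vector. -/
def vecVar {Ω E : Type*} [MeasurableSpace Ω] [NormedAddCommGroup E] [NormedSpace ℝ E]
    (X : Ω → E) (μ : Measure Ω) : ℝ := ∫ ω, ‖X ω - ∫ ω', X ω' ∂μ‖ ^ 2 ∂μ

/-! ### Parametrized policies -/

/-- A family of policies `π_θ`, `θ ∈ ℝ^d`, given by probability densities `π_θ(a | s)` with respect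
to a reference measure `ν` on actions. -/
structure PolicyFamily (d : ℕ) (S : Type*) {A : Type*} [MeasurableSpace S] [MeasurableSpace A]
    (ν : Measure A) where
  /-- the density `π_θ(a | s)` -/
  dens : EuclideanSpace ℝ (Fin d) → S → A → ℝ
  measurable_dens : ∀ θ, Measurable (Function.uncurry (dens θ))
  dens_nonneg : ∀ θ s a, 0 ≤ dens θ s a
  lintegral_dens : ∀ θ s, ∫⁻ a, ENNReal.ofReal (dens θ s a) ∂ν = 1

namespace PolicyFamily

variable {d : ℕ} {ν : Measure A}

/-- The policy `π_θ` as a Markov kernel. -/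
def kernel [SFinite ν] (F : PolicyFamily d S ν) (θ : EuclideanSpace ℝ (Fin d)) : Kernel S A :=
  (Kernel.const S ν).withDensity (fun s a => ENNReal.ofReal (F.dens θ s a))

lemma kernel_apply [SFinite ν] (F : PolicyFamily d S ν) (θ : EuclideanSpace ℝ (Fin d)) (s : S) :
    F.kernel θ s = ν.withDensity (fun a => ENNReal.ofReal (F.dens θ s a)) := by
  have h : Measurable (Function.uncurry fun s a => ENNReal.ofReal (F.dens θ s a)) :=
    (F.measurable_dens θ).ennreal_ofReal
  rw [kernel, Kernel.withDensity_apply _ h, Kernel.const_apply]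

instance [SFinite ν] (F : PolicyFamily d S ν) (θ : EuclideanSpace ℝ (Fin d)) :
    IsMarkovKernel (F.kernel θ) :=
  ⟨fun s => ⟨by
    rw [kernel_apply, withDensity_apply _ MeasurableSet.univ, Measure.restrict_univ,
      F.lintegral_dens]⟩⟩

/-- The score `u_θ(s, a) = ∇_θ log π_θ(a | s)`. -/
def score (F : PolicyFamily d S ν) (θ : EuclideanSpace ℝ (Fin d)) (s : S) (a : A) :
    EuclideanSpace ℝ (Fin d) :=
  gradient (fun θ' => Real.log (F.dens θ' s a)) θ

/-- Smoothness of the parametrization at `θ`: in each state `s`, for almost every action, the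
density is differentiable in the parameter at `θ`, with difference quotients near `θ` that are
dominated by an integrable function of the action. -/
def RegularAt (F : PolicyFamily d S ν) (θ : EuclideanSpace ℝ (Fin d)) : Prop :=
  ∀ s, ∃ g : A → ℝ, Integrable g ν ∧ ∃ ε > 0, ∀ᵐ a ∂ν,
    DifferentiableAt ℝ (fun θ' => F.dens θ' s a) θ ∧
    ∀ θ' ∈ Metric.ball θ ε, |F.dens θ' s a - F.dens θ s a| ≤ g a * ‖θ' - θ‖

end PolicyFamily

end UAE

end

/-! Write `adv` for Q - V, κ for γλ, `td` for the temporal difference r + γV(s') - V(s), and Ψ = V +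
ε·`adv` with ε = 1 or 0 (so ε² = ε). Take t = 0. Regrouping the series (`uae_eq_gae_add`) gives UAE
= G + c + γ(1-λ)ε·M, where G is GAE, c = V(s_0) - b(s_0) and M = ∑ κ^l `adv`_{l+1}.

Two conditional means control everything. By the Bellman equation `td`_n has mean `adv`_n given the
history up to (s_n, a_n) (`integral_td_smul`), and `adv`_{n+1} has mean 0 given everything before
a_{n+1} (`integral_adv_smul`). Hence E[`adv`_{l+1} `td`_j] and E[`adv`_{l+1} `adv`_{j+1}] vanish off
the diagonals j = l+1 and j = l, so that E[GM] = ∑ κ^{2l+1} E[`adv`_{l+1}²] and E[M²] = ∑ κ^{2l}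
E[`adv`_{l+1}²]. Moreover E[cM] = 0 and E[cG] = E[c·`adv`_0]. Expanding the square, the M-terms
carry 2γ(1-λ)κ + γ²(1-λ)² = γ²(1-λ²), the irreducible part, and E[c² + 2c·`adv`_0] is the reducible
part.

The weight ‖u‖² depends on (s_0, a_0) only, so it is absorbed into the initial law: the reweighted
trajectory law is again a trajectory law, started from an s-finite measure of possibly infinite mass
(`comp_trajSA_withDensity`). Second moments are therefore computed without weight for an arbitrary
initial law m (`second_moment_uae_sub_gae`). Under m the first action need not follow π; this is why
`adv`_0 survives in the reducible part and why centring is used only from time 1 on.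

Variances differ as second moments do because the means agree: E[cu] = 0 since the score has mean
zero in each state, and E[Mu] = 0 by centring. A general t reduces to t = 0 by the Markov property,
with the law of s_t as initial law. -/

set_option linter.unusedSectionVars false

/-! ### Trajectory laws and the Markov property -/

noncomputable section

namespace UAE

variable {S A : Type*} [MeasurableSpace S] [MeasurableSpace A]

/-- The state-action pair of a record. -/
def pair (y : (ℝ × S) × A) : S × A := (y.1.2, y.2)

@[fun_prop]
lemma measurable_pair : Measurable (pair : (ℝ × S) × A → S × A) := by unfold pair; fun_prop

lemma measurable_record (n : ℕ) : Measurable fun ω : Traj S A => ω n := measurable_pi_apply n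

@[fun_prop]
lemma measurable_st (n : ℕ) : Measurable fun ω : Traj S A => st ω n := by unfold st; fun_prop

@[fun_prop]
lemma measurable_act (n : ℕ) : Measurable fun ω : Traj S A => act ω n := by unfold act; fun_prop

@[fun_prop]
lemma measurable_rew (n : ℕ) : Measurable fun ω : Traj S A => rew ω n := by unfold rew; fun_prop

/-- The trajectory from time `n` on, with the dummy reward slot reset. -/
def restart (n : ℕ) (ω : Traj S A) : Traj S A :=
  fun k => ((if k = 0 then 0 else (ω (n + k)).1.1, (ω (n + k)).1.2), (ω (n + k)).2)

@[fun_prop]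
lemma measurable_restart (n : ℕ) : Measurable (restart n : Traj S A → Traj S A) := by
  unfold restart
  refine measurable_pi_lambda _ fun k => ?_
  split_ifs <;> fun_prop

@[simp] lemma st_restart (n k : ℕ) (ω : Traj S A) : st (restart n ω) k = st ω (n + k) := rfl

@[simp] lemma act_restart (n k : ℕ) (ω : Traj S A) : act (restart n ω) k = act ω (n + k) := rfl

@[simp] lemma rew_restart (n k : ℕ) (ω : Traj S A) : rew (restart n ω) k = rew ω (n + k) := by
  simp [rew, restart, add_assoc]

lemma restart_restart_one (n : ℕ) (ω : Traj S A) :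
    restart 1 (restart n ω) = restart (n + 1) ω := by
  ext k : 1
  simp [restart, add_assoc]

variable (P : Kernel (S × A) (ℝ × S)) [IsMarkovKernel P] (π : Kernel S A) [IsMarkovKernel π]

instance : IsMarkovKernel (trajSA P π) := by unfold trajSA; infer_instance

instance : IsMarkovKernel (trajS P π) := by unfold trajS; infer_instance

instance (ρ : Measure S) [IsProbabilityMeasure ρ] : IsProbabilityMeasure (trajLaw P π ρ) := by
  unfold trajLaw; infer_instance

/-- The transition kernel of the chain of state-action pairs. -/
def pairKernel : Kernel (S × A) (S × A) := (stepKernel P π).map pair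

instance : IsMarkovKernel (pairKernel P π) := by
  unfold pairKernel; exact Kernel.IsMarkovKernel.map _ measurable_pair

lemma histKernel_apply (n : ℕ) (h : Π _ : Finset.Iic n, (ℝ × S) × A) :
    histKernel P π n h = stepKernel P π (pair (h ⟨n, Finset.mem_Iic.2 le_rfl⟩)) := rfl

lemma trajSA_apply (x : S × A) :
    trajSA P π x = Kernel.traj (X := fun _ => (ℝ × S) × A) (histKernel P π) 0
      (fun _ => (((0 : ℝ), x.1), x.2)) := rfl

/-- Under `trajSA`, the next record is drawn from `histKernel` given the history. -/
lemma trajSA_map_hist_succ (x : S × A) (n : ℕ) :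
    (trajSA P π x).map (fun ω => (Preorder.frestrictLe (π := fun _ => (ℝ × S) × A) n ω, ω (n + 1)))
      = ((trajSA P π x).map (Preorder.frestrictLe n)) ⊗ₘ histKernel P π n := by
  rw [trajSA_apply, ← Kernel.partialTraj_compProd_eq_map_traj (Nat.zero_le n),
    Kernel.traj_map_frestrictLe_apply]

lemma comp_trajSA_map_hist_succ (m : Measure (S × A)) [SFinite m] (n : ℕ) :
    (trajSA P π ∘ₘ m).map
        (fun ω => (Preorder.frestrictLe (π := fun _ => (ℝ × S) × A) n ω, ω (n + 1)))
      = ((trajSA P π ∘ₘ m).map (Preorder.frestrictLe n)) ⊗ₘ histKernel P π n := by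
  rw [Measure.compProd_eq_comp_prod, Measure.map_comp _ _ (by fun_prop),
    Measure.map_comp _ _ (by fun_prop), Measure.comp_assoc]
  congr with x : 1
  rw [Kernel.comp_apply, ← Measure.compProd_eq_comp_prod, Kernel.map_apply _ (by fun_prop),
    Kernel.map_apply _ (by fun_prop), trajSA_map_hist_succ]

lemma trajSA_map_zero (x : S × A) :
    (trajSA P π x).map (fun ω => ω 0) = Measure.dirac ((0, x.1), x.2) := by
  have h : (fun ω : Traj S A => ω 0) = (fun h : Π _ : Finset.Iic 0, (ℝ × S) × A =>
      h ⟨0, Finset.mem_Iic.2 le_rfl⟩) ∘ Preorder.frestrictLe (π := fun _ => (ℝ × S) × A) 0 := rfl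
  rw [h, ← Measure.map_map (by fun_prop) (by fun_prop), trajSA_apply,
    Kernel.traj_map_frestrictLe_apply, Kernel.partialTraj_self, Kernel.id_apply]
  exact Measure.map_dirac' (by fun_prop) _

/-- Makes the law of the longer history an image of the joint law of the shorter one and the next
record, which is the form that an induction on time can use. -/
lemma exists_hist_extend {n : ℕ} : ∃ f : (Π _ : Finset.Iic n, (ℝ × S) × A) × ((ℝ × S) × A) →
      (Π _ : Finset.Iic (n + 1), (ℝ × S) × A), Measurable f ∧
      Preorder.frestrictLe (π := fun _ => (ℝ × S) × A) (n + 1)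
        = f ∘ fun ω : Traj S A => (Preorder.frestrictLe (π := fun _ => (ℝ × S) × A) n ω, ω (n + 1)) := by
  refine ⟨fun p i => if h : (i : ℕ) ≤ n then p.1 ⟨i, Finset.mem_Iic.2 h⟩ else p.2, ?_, ?_⟩
  · refine measurable_pi_lambda _ fun i => ?_
    split_ifs <;> fun_prop
  · ext ω i : 2
    by_cases h : (i : ℕ) ≤ n
    · simp [h]
    · have : (i : ℕ) = n + 1 := le_antisymm (Finset.mem_Iic.1 i.2) (by omega)
      simp [this]

variable {P π}

/-- A law on trajectories is determined by its initial law and by the transition kernel. -/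
lemma traj_measure_ext {μ₁ μ₂ : Measure (Traj S A)} [IsFiniteMeasure μ₁] [IsFiniteMeasure μ₂]
    (h0 : μ₁.map (fun ω => ω 0) = μ₂.map (fun ω => ω 0))
    (h1 : ∀ n, μ₁.map
        (fun ω => (Preorder.frestrictLe (π := fun _ => (ℝ × S) × A) n ω, ω (n + 1)))
      = (μ₁.map (Preorder.frestrictLe n)) ⊗ₘ histKernel P π n)
    (h2 : ∀ n, μ₂.map
        (fun ω => (Preorder.frestrictLe (π := fun _ => (ℝ × S) × A) n ω, ω (n + 1)))
      = (μ₂.map (Preorder.frestrictLe n)) ⊗ₘ histKernel P π n) : μ₁ = μ₂ := by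
  have key : ∀ n, μ₁.map (Preorder.frestrictLe (π := fun _ => (ℝ × S) × A) n)
      = μ₂.map (Preorder.frestrictLe (π := fun _ => (ℝ × S) × A) n) := by
    intro n
    induction n with
    | zero =>
      have h : Preorder.frestrictLe (π := fun _ => (ℝ × S) × A) 0
          = (fun (y : (ℝ × S) × A) (_ : Finset.Iic 0) => y) ∘ fun ω : Traj S A => ω 0 := by
        ext ω i : 2
        have : (i : ℕ) = 0 := by simpa using Finset.mem_Iic.1 i.2
        simp [this]
      rw [h, ← Measure.map_map (by fun_prop) (by fun_prop), h0,
        Measure.map_map (by fun_prop) (by fun_prop)]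
    | succ n ih =>
      obtain ⟨f, hf, h⟩ := exists_hist_extend (S := S) (A := A) (n := n)
      rw [h, ← Measure.map_map hf (by fun_prop), h1, ih, ← h2, Measure.map_map hf (by fun_prop)]
  -- Any finite set of times lies in an initial segment, so the finite-dimensional marginals agree,
  -- and these determine the measure.
  have hproj : ∀ I : Finset ℕ, μ₁.map I.restrict = μ₂.map I.restrict := by
    intro I
    have h := I.subset_Iic_sup_id
    rw [← Finset.restrict₂_comp_restrict h, ← Measure.map_map (Finset.measurable_restrict₂ h) (Finset.measurable_restrict _),
      ← Measure.map_map (Finset.measurable_restrict₂ h) (Finset.measurable_restrict _)]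
    exact congrArg _ (key _)
  exact IsProjectiveLimit.unique (P := fun I => μ₂.map I.restrict) hproj fun _ => rfl

variable (P π)

lemma trajSA_map_one (x : S × A) :
    (trajSA P π x).map (fun ω => ω 1) = stepKernel P π x := by
  have h : (fun ω : Traj S A => ω 1) = (fun ω : Traj S A => ω (0 + 1)) := rfl
  rw [trajSA_apply, h, ← Kernel.map_apply _ (by fun_prop), Kernel.map_traj_succ_self,
    histKernel_apply]
  rfl

/-- Both sides have the same initial record law and the same transition kernel, since `histKernel`
sees only the last state and action; `traj_measure_ext` concludes. Resetting the dummy reward is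
what makes the initial records match. -/
lemma trajSA_map_restart_one (x : S × A) :
    (trajSA P π x).map (restart 1) = trajSA P π ∘ₘ (pairKernel P π x) := by
  have : IsProbabilityMeasure ((trajSA P π x).map (restart 1)) :=
    Measure.isProbabilityMeasure_map (by fun_prop)
  refine traj_measure_ext (P := P) (π := π) ?_ (fun n => ?_)
    (fun n => comp_trajSA_map_hist_succ P π _ n)
  · rw [Measure.map_map (by fun_prop) (by fun_prop), Measure.map_comp _ _ (by fun_prop)]
    have h1 : ((fun ω : Traj S A => ω 0) ∘ restart 1)
        = (fun x : S × A => (((0 : ℝ), x.1), x.2)) ∘ pair ∘ fun ω : Traj S A => ω 1 := rfl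
    have h2 : (trajSA P π).map (fun ω => ω 0)
        = Kernel.deterministic (fun x : S × A => (((0 : ℝ), x.1), x.2)) (by fun_prop) := by
      ext x : 1
      rw [Kernel.map_apply _ (by fun_prop), trajSA_map_zero, Kernel.deterministic_apply]
    rw [h1, h2, Measure.deterministic_comp_eq_map, ← Measure.map_map (by fun_prop) (by fun_prop),
      ← Measure.map_map (by fun_prop) (by fun_prop), trajSA_map_one, pairKernel,
      Kernel.map_apply _ (by fun_prop)]
  -- `φ` is `restart 1` on finite histories. The transition after the longer history factors through
  -- it because the last pair is preserved.
  · let φ : (Π _ : Finset.Iic (n + 1), (ℝ × S) × A) → (Π _ : Finset.Iic n, (ℝ × S) × A) :=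
      fun h i => ((if (i : ℕ) = 0 then 0
        else (h ⟨1 + i, Finset.mem_Iic.2 (by have := Finset.mem_Iic.1 i.2; omega)⟩).1.1,
        (h ⟨1 + i, Finset.mem_Iic.2 (by have := Finset.mem_Iic.1 i.2; omega)⟩).1.2),
        (h ⟨1 + i, Finset.mem_Iic.2 (by have := Finset.mem_Iic.1 i.2; omega)⟩).2)
    have hφ : Measurable φ := by
      refine measurable_pi_lambda _ fun i => ?_
      simp only [φ]
      split_ifs <;> fun_prop
    have h1 : (fun ω : Traj S A => (Preorder.frestrictLe (π := fun _ => (ℝ × S) × A) n ω, ω (n + 1)))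
        ∘ restart 1 = Prod.map φ id ∘ fun ω : Traj S A =>
          (Preorder.frestrictLe (π := fun _ => (ℝ × S) × A) (n + 1) ω, ω (n + 1 + 1)) := by
      ext ω : 1
      refine Prod.ext ?_ ?_
      · rfl
      · simp [restart, add_comm]
    have h2 : Preorder.frestrictLe (π := fun _ => (ℝ × S) × A) n ∘ restart 1
        = φ ∘ Preorder.frestrictLe (π := fun _ => (ℝ × S) × A) (n + 1) := rfl
    have h3 : histKernel P π (n + 1) = (histKernel P π n).comap φ hφ := by
      ext h : 1
      rw [Kernel.comap_apply, histKernel_apply, histKernel_apply]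
      congr 1
      have : (⟨1 + n, Finset.mem_Iic.2 (by omega)⟩ : Finset.Iic (n + 1))
        = ⟨n + 1, Finset.mem_Iic.2 le_rfl⟩ := by simp [add_comm]
      simp only [pair, φ, this]
    rw [Measure.map_map (by fun_prop) (by fun_prop), Measure.map_map (by fun_prop) (by fun_prop),
      h1, h2, ← Measure.map_map (by fun_prop) (by fun_prop), trajSA_map_hist_succ, h3]
    have := Measure.isProbabilityMeasure_map (μ := trajSA P π x)
      (f := Preorder.frestrictLe (π := fun _ => (ℝ × S) × A) (n + 1)) (by fun_prop)
    ext s hs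
    rw [Measure.map_apply (by fun_prop) hs, Measure.compProd_apply
      ((hφ.prodMap measurable_id) hs), Measure.compProd_apply hs,
      lintegral_map (Kernel.measurable_kernel_prodMk_left hs) (by fun_prop),
      lintegral_map (Kernel.measurable_kernel_prodMk_left ((hφ.prodMap measurable_id) hs))
        (by fun_prop)]
    rfl

/-- The Markov property at time `1`. -/
lemma comp_trajSA_map_restart_one (m : Measure (S × A)) :
    (trajSA P π ∘ₘ m).map (restart 1) = trajSA P π ∘ₘ (pairKernel P π ∘ₘ m) := by
  rw [Measure.map_comp _ _ (by fun_prop), Measure.comp_assoc]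
  congr with x : 1
  rw [Kernel.map_apply _ (by fun_prop), trajSA_map_restart_one, Kernel.comp_apply]

/-- The law of the `n`-th state-action pair, if the initial one has law `m`. -/
def pairLaw (m : Measure (S × A)) : ℕ → Measure (S × A)
  | 0 => m
  | n + 1 => pairKernel P π ∘ₘ pairLaw m n

instance (m : Measure (S × A)) [SFinite m] (n : ℕ) : SFinite (pairLaw P π m n) := by
  induction n with
  | zero => assumption
  | succ n ih => rw [pairLaw]; infer_instance

instance (m : Measure (S × A)) [IsProbabilityMeasure m] (n : ℕ) :
    IsProbabilityMeasure (pairLaw P π m n) := by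
  induction n with
  | zero => assumption
  | succ n ih => rw [pairLaw]; infer_instance

/-- `restart 0` only resets the dummy reward, which already vanishes almost surely. -/
lemma trajSA_map_restart_zero : (trajSA P π).map (restart 0) = trajSA P π := by
  ext x : 1
  have h0 : ∀ᵐ ω ∂(trajSA P π x), (ω 0).1.1 = 0 := by
    have h : ∀ᵐ y ∂((trajSA P π x).map (fun ω => ω 0)), y.1.1 = 0 := by
      rw [trajSA_map_zero, ae_dirac_iff (measurableSet_eq_fun (by fun_prop) (by fun_prop))]
    exact ae_of_ae_map (measurable_record 0).aemeasurable h
  rw [Kernel.map_apply _ (by fun_prop)]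
  conv_rhs => rw [← Measure.map_id (μ := trajSA P π x)]
  refine Measure.map_congr ?_
  filter_upwards [h0] with ω hω
  ext k : 1
  rcases Nat.eq_zero_or_pos k with rfl | hk
  · simp only [restart, ← hω, if_true, id]
  · simp [restart, hk.ne']

/-- The Markov property. -/
lemma comp_trajSA_map_restart (m : Measure (S × A)) (n : ℕ) :
    (trajSA P π ∘ₘ m).map (restart n) = trajSA P π ∘ₘ pairLaw P π m n := by
  induction n with
  | zero => rw [Measure.map_comp _ _ (by fun_prop), trajSA_map_restart_zero, pairLaw]
  | succ n ih =>
    have h : (restart (n + 1) : Traj S A → Traj S A) = restart 1 ∘ restart n := by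
      ext1 ω; simp [restart_restart_one]
    rw [h, ← Measure.map_map (by fun_prop) (by fun_prop), ih, comp_trajSA_map_restart_one, pairLaw]

end UAE

end

/-! ### Series in L^p, conditional expectation and variance -/

noncomputable section

namespace UAE

/-- In ℝ summability is absolute summability, a measurable condition; on it the sum is a limit of
partial sums, and elsewhere `tsum` takes the default value 0. -/
lemma measurable_real_tsum {Ω : Type*} [MeasurableSpace Ω] {f : ℕ → Ω → ℝ}
    (hf : ∀ n, Measurable (f n)) : Measurable fun ω => ∑' n, f n ω := by
  classical
  have h1 : (fun ω => ∑' n, f n ω) = fun ω => if ∑' n, ‖f n ω‖ₑ ≠ ∞ then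
      Filter.limUnder Filter.atTop (fun N => ∑ n ∈ Finset.range N, f n ω) else 0 := by
    ext ω
    split_ifs with h
    · have hs : Summable fun n => f n ω := (tsum_enorm_ne_top_iff_summable_norm.1 h).of_norm
      exact hs.hasSum.tendsto_sum_nat.limUnder_eq.symm
    · refine tsum_eq_zero_of_not_summable fun hs => h ?_
      exact tsum_enorm_ne_top_iff_summable_norm.2 hs.norm
  rw [h1]
  refine Measurable.ite ?_ ?_ measurable_const
  · exact (measurableSet_singleton (∞ : ℝ≥0∞)).compl.preimage
      (Measurable.tsum fun n => (hf n).enorm)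
  · exact (StronglyMeasurable.limUnder fun N =>
      (Finset.measurable_sum _ fun n _ => hf n).stronglyMeasurable).measurable

lemma hasSum_of_forall_eq {f g : ℕ → ℝ} {a : ℝ} (h : ∀ n, f n = g n) (hg : HasSum g a) :
    HasSum f a := by
  rwa [funext h]

section Series

variable {Ω E : Type*} [MeasurableSpace Ω] [NormedAddCommGroup E] [NormedSpace ℝ E]
  [CompleteSpace E] {μ : Measure Ω} {f : ℕ → Ω → E} {p : ℝ≥0∞} [hp : Fact (1 ≤ p)]

lemma ae_summable_of_tsum_eLpNorm_ne_top (hf : ∀ n, MemLp (f n) p μ)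
    (hs : ∑' n, eLpNorm (f n) p μ ≠ ∞) : ∀ᵐ ω ∂μ, Summable fun n => f n ω := by
  filter_upwards [summable_norm_of_tsum_eLpNorm_ne_top hp.out
    (fun n => (hf n).aestronglyMeasurable) hs] with ω h using h.of_norm

/-- The series converges absolutely in the Banach space `Lp`, and its sum there agrees almost
everywhere with the pointwise one. -/
lemma memLp_tsum_of_tsum_eLpNorm_ne_top (hf : ∀ n, MemLp (f n) p μ)
    (hs : ∑' n, eLpNorm (f n) p μ ≠ ∞) :
    MemLp (fun ω => ∑' n, f n ω) p μ ∧
      eLpNorm (fun ω => ∑' n, f n ω) p μ ≤ ∑' n, eLpNorm (f n) p μ := by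
  have hn : ∀ n, ‖(hf n).toLp (f n)‖ₑ = eLpNorm (f n) p μ := fun n => by
    rw [Lp.enorm_def, eLpNorm_congr_ae (hf n).coeFn_toLp]
  have hs' : ∑' n, ‖(hf n).toLp (f n)‖ₑ ≠ ∞ := by simpa only [hn] using hs
  have h1 : (fun ω => ∑' n, f n ω) =ᵐ[μ] (∑' n, (hf n).toLp (f n) : Lp E p μ) := by
    have h2 : ∀ᵐ ω ∂μ, ∀ n, (hf n).toLp (f n) ω = f n ω :=
      ae_all_iff.2 fun n => (hf n).coeFn_toLp
    filter_upwards [Lp.coeFn_tsum hs', h2] with ω h h'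
    rw [h]
    simp only [h']
  refine ⟨(memLp_congr_ae h1).2 (Lp.memLp _), ?_⟩
  rw [eLpNorm_congr_ae h1, ← Lp.enorm_def]
  simp only [← hn]
  exact enorm_tsum_le_tsum_enorm

/-- By Hölder the products are absolutely summable in L¹. Pairing two L² functions avoids any need
for a finite measure. -/
lemma hasSum_integral_smul_of_tsum_eLpNorm_ne_top (hf : ∀ n, MemLp (f n) 2 μ)
    (hs : ∑' n, eLpNorm (f n) 2 μ ≠ ∞) {g : Ω → ℝ} (hg : MemLp g 2 μ) :
    HasSum (fun n => ∫ ω, g ω • f n ω ∂μ) (∫ ω, g ω • ∑' n, f n ω ∂μ) := by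
  have h1 : ∀ n, eLpNorm (fun ω => g ω • f n ω) 1 μ ≤ eLpNorm g 2 μ * eLpNorm (f n) 2 μ :=
    fun n => eLpNorm_smul_le_mul_eLpNorm (hf n).aestronglyMeasurable hg.aestronglyMeasurable
  have h2 : ∀ n, Integrable (fun ω => g ω • f n ω) μ := fun n => memLp_one_iff_integrable.1 ((hf n).smul hg)
  have h3 : ∀ ω, g ω • ∑' n, f n ω = ∑' n, g ω • f n ω := fun ω => (tsum_const_smul'' _).symm
  simp only [h3]
  refine hasSum_integral_of_summable_integral_norm h2 ?_
  have h4 : ∑' n, eLpNorm (fun ω => g ω • f n ω) 1 μ ≠ ∞ := by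
    refine ne_top_of_le_ne_top ?_ (ENNReal.tsum_le_tsum h1)
    rw [ENNReal.tsum_mul_left]
    exact ENNReal.mul_ne_top hg.2.ne hs
  have h5 : ∀ n, ∫ ω, ‖g ω • f n ω‖ ∂μ = (eLpNorm (fun ω => g ω • f n ω) 1 μ).toReal := fun n => by
    rw [eLpNorm_one_eq_lintegral_enorm, integral_norm_eq_lintegral_enorm (h2 n).1]
  simp only [h5]
  exact ENNReal.summable_toReal h4

lemma tsum_eLpNorm_geometric_le {κ : ℝ} (h0 : 0 ≤ κ) (h1 : κ < 1) {C : ℝ≥0}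
    (hC : ∀ n, eLpNorm (f n) 2 μ ≤ C) :
    ∑' n, eLpNorm (fun ω => κ ^ n • f n ω) 2 μ ≤ ENNReal.ofReal (1 - κ)⁻¹ * C := by
  have h : ∀ n, eLpNorm (fun ω => κ ^ n • f n ω) 2 μ ≤ ENNReal.ofReal (κ ^ n) * C := fun n => by
    have := eLpNorm_const_smul_le (c := κ ^ n) (f := f n) (p := 2) (μ := μ)
    refine this.trans ?_
    rw [Real.enorm_of_nonneg (by positivity)]
    gcongr
    exact hC n
  refine (ENNReal.tsum_le_tsum h).trans ?_
  rw [ENNReal.tsum_mul_right, ← ENNReal.ofReal_tsum_of_nonneg (fun n => by positivity)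
    (summable_geometric_of_lt_one h0 h1), tsum_geometric_of_lt_one h0 h1]

end Series

section Kernel

variable {X Y E : Type*} [MeasurableSpace X] [MeasurableSpace Y]
  [NormedAddCommGroup E] [NormedSpace ℝ E]

lemma eLpNorm_two_sq_eq_lintegral {μ : Measure X} (f : X → E) :
    eLpNorm f 2 μ ^ 2 = ∫⁻ x, ‖f x‖ₑ ^ 2 ∂μ := by
  have := eLpNorm_nnreal_pow_eq_lintegral (f := f) (μ := μ) (p := 2) (by norm_num)
  simpa using this

/-- Conditional expectation is a contraction of `L²`. -/
lemma eLpNorm_integral_kernel_le (η : Kernel X Y) [IsMarkovKernel η] (m : Measure X)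
    {f : Y → E} (hf : StronglyMeasurable f) :
    eLpNorm (fun x => ∫ y, f y ∂(η x)) 2 m ≤ eLpNorm f 2 (η ∘ₘ m) := by
  refine (ENNReal.pow_le_pow_left_iff two_ne_zero).1 ?_
  rw [eLpNorm_two_sq_eq_lintegral, eLpNorm_two_sq_eq_lintegral,
    Measure.lintegral_bind η.aemeasurable (by fun_prop)]
  refine lintegral_mono fun x => ?_
  have h1 : ‖∫ y, f y ∂(η x)‖ₑ ≤ eLpNorm f 1 (η x) := by
    rw [eLpNorm_one_eq_lintegral_enorm]
    exact enorm_integral_le_lintegral_enorm _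
  have h2 : eLpNorm f 1 (η x) ≤ eLpNorm f 2 (η x) :=
    eLpNorm_le_eLpNorm_of_exponent_le (by norm_num) hf.aestronglyMeasurable
  rw [← eLpNorm_two_sq_eq_lintegral]
  gcongr
  exact h1.trans h2

end Kernel

section Variance

variable {Ω E : Type*} [MeasurableSpace Ω] [NormedAddCommGroup E] [InnerProductSpace ℝ E]
  [CompleteSpace E] {μ : Measure Ω}

lemma vecVar_eq_sub [IsProbabilityMeasure μ] {X : Ω → E} (hX : MemLp X 2 μ) :
    vecVar X μ = ∫ ω, ‖X ω‖ ^ 2 ∂μ - ‖∫ ω, X ω ∂μ‖ ^ 2 := by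
  set c := ∫ ω, X ω ∂μ with hc
  have hi : Integrable X μ := hX.integrable (by norm_num)
  have h2 : Integrable (fun ω => ‖X ω‖ ^ 2) μ := (memLp_two_iff_integrable_sq_norm hX.1).1 hX
  have h3 : Integrable (fun ω => inner ℝ c (X ω)) μ := hi.const_inner c
  have h4 : ∀ ω, ‖X ω - c‖ ^ 2 = ‖X ω‖ ^ 2 - 2 * inner ℝ c (X ω) + ‖c‖ ^ 2 := fun ω => by
    rw [norm_sub_sq_real, real_inner_comm]
  unfold vecVar
  simp only [← hc, h4]
  rw [integral_add (f := fun ω => ‖X ω‖ ^ 2 - 2 * inner ℝ c (X ω)) (h2.sub (h3.const_mul 2))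
    (integrable_const _),
    integral_sub h2 (h3.const_mul 2), integral_const_mul, integral_inner hi, ← hc,
    real_inner_self_eq_norm_sq]
  simp
  ring

end Variance

end UAE

end

/-! ### Value functions and the Bellman equation -/

noncomputable section

namespace UAE

lemma integral_comp_measure {X Y E : Type*} [MeasurableSpace X] [MeasurableSpace Y]
    [NormedAddCommGroup E] [NormedSpace ℝ E] {η : Kernel X Y} {m : Measure X} {f : Y → E}
    (hf : Integrable f (η ∘ₘ m)) : ∫ y, f y ∂(η ∘ₘ m) = ∫ x, ∫ y, f y ∂(η x) ∂m := by
  rw [Measure.comp_eq_comp_const_apply] at hf ⊢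
  rw [Kernel.integral_comp hf, Kernel.const_apply]

variable {S A : Type*} [MeasurableSpace S] [MeasurableSpace A]

@[fun_prop]
lemma measurable_ret (γ : ℝ) : Measurable (ret γ : Traj S A → ℝ) :=
  measurable_real_tsum fun n => by fun_prop

lemma enorm_ret_le_absRet (γ : ℝ) (ω : Traj S A) : ‖ret γ ω‖ₑ ≤ absRet γ ω :=
  enorm_tsum_le_tsum_enorm

lemma enorm_rew_zero_le_absRet (γ : ℝ) (ω : Traj S A) : ‖rew ω 0‖ₑ ≤ absRet γ ω := by
  have := ENNReal.le_tsum (f := fun k => ‖γ ^ k * rew ω k‖ₑ) 0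
  simpa [absRet] using this

@[fun_prop]
lemma measurable_absRet (γ : ℝ) : Measurable (absRet γ : Traj S A → ℝ≥0∞) :=
  Measurable.tsum fun n => by fun_prop

lemma ret_eq_add_restart {γ : ℝ} {ω : Traj S A} (h : absRet γ ω ≠ ∞) :
    ret γ ω = rew ω 0 + γ * ret γ (restart 1 ω) := by
  have hs : Summable fun k => γ ^ k * rew ω k := (tsum_enorm_ne_top_iff_summable_norm.1 h).of_norm
  rw [ret, hs.tsum_eq_zero_add, ret, ← tsum_mul_left]
  simp [pow_succ', mul_assoc, add_comm 1]

variable (P : Kernel (S × A) (ℝ × S)) [IsMarkovKernel P] (π : Kernel S A) [IsMarkovKernel π]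
  (γ : ℝ)

@[fun_prop]
lemma measurable_Qval : Measurable fun x : S × A => Qval P π γ x.1 x.2 :=
  ((measurable_ret γ).stronglyMeasurable.integral_kernel (κ := trajSA P π)).measurable

@[fun_prop]
lemma measurable_Vval : Measurable fun s : S => Vval P π γ s :=
  ((measurable_ret γ).stronglyMeasurable.integral_kernel (κ := trajS P π)).measurable

/-- The advantage function `Q^π - V^π`. -/
def adv (x : S × A) : ℝ := Qval P π γ x.1 x.2 - Vval P π γ x.1

@[fun_prop]
lemma measurable_adv : Measurable (adv P π γ) := by unfold adv; fun_prop

variable {P π γ}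

lemma integrable_ret (hQ : ∀ s a, ∫⁻ ω, absRet γ ω ∂(trajSA P π (s, a)) < ∞) (x : S × A) :
    Integrable (ret γ) (trajSA P π x) :=
  ⟨by fun_prop, (lintegral_mono fun ω => enorm_ret_le_absRet γ ω).trans_lt (hQ x.1 x.2)⟩

lemma integrable_rew_zero (hQ : ∀ s a, ∫⁻ ω, absRet γ ω ∂(trajSA P π (s, a)) < ∞) (x : S × A) :
    Integrable (fun ω => rew ω 0) (trajSA P π x) :=
  ⟨by fun_prop, (lintegral_mono fun ω => enorm_rew_zero_le_absRet γ ω).trans_lt (hQ x.1 x.2)⟩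

lemma trajS_apply (s : S) :
    trajS P π s = ((trajSA P π).comap (Prod.mk s) (by fun_prop)) ∘ₘ (π s) := by
  have h : (Kernel.id ×ₖ π) s = (π s).map (Prod.mk s) := by
    rw [Kernel.prod_apply, Kernel.id_apply, Measure.dirac_prod]
  rw [trajS, Kernel.comp_apply, h]
  ext t ht
  rw [Measure.bind_apply ht (Kernel.aemeasurable _), Measure.bind_apply ht (Kernel.aemeasurable _),
    lintegral_map (Kernel.measurable_coe _ ht) (by fun_prop)]
  rfl

/-- Tower property: `trajS` is the mixture of `trajSA` over the first action. Integrability of Q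
passes down from that of the return. -/
lemma integrable_Qval_and_integral
    (hV : ∀ s, ∫⁻ ω, absRet γ ω ∂(trajS P π s) < ∞) (s : S) :
    Integrable (fun a => Qval P π γ s a) (π s) ∧ ∫ a, Qval P π γ s a ∂(π s) = Vval P π γ s := by
  have hi : Integrable (ret γ) (trajS P π s) :=
    ⟨by fun_prop, (lintegral_mono fun ω => enorm_ret_le_absRet γ ω).trans_lt (hV s)⟩
  have hV' : Vval P π γ s = ∫ ω, ret γ ω ∂(trajS P π s) := rfl
  rw [trajS_apply] at hi hV'
  refine ⟨?_, ?_⟩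
  · have := Measure.integrable_integral_norm_of_integrable_comp hi
    refine this.mono ?_ (Filter.Eventually.of_forall fun a => ?_)
    · exact ((measurable_Qval P π γ).comp (measurable_prodMk_left (x := s))).aestronglyMeasurable
    · refine (norm_integral_le_integral_norm _).trans (le_abs_self _)
  · rw [hV', integral_comp_measure hi]
    rfl

lemma integral_adv (hV : ∀ s, ∫⁻ ω, absRet γ ω ∂(trajS P π s) < ∞) (s : S) :
    ∫ a, adv P π γ (s, a) ∂(π s) = 0 := by
  obtain ⟨h1, h2⟩ := integrable_Qval_and_integral hV s
  unfold adv
  simp only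
  rw [integral_sub h1 (integrable_const _), h2]
  simp

lemma integrable_restart_one (hQ : ∀ s a, ∫⁻ ω, absRet γ ω ∂(trajSA P π (s, a)) < ∞) (x : S × A) :
    (fun ω => ret γ ω) =ᵐ[trajSA P π x] (fun ω => rew ω 0 + γ * ret γ (restart 1 ω)) ∧
    Integrable (fun ω => γ * ret γ (restart 1 ω)) (trajSA P π x) := by
  have h : (fun ω => ret γ ω) =ᵐ[trajSA P π x] (fun ω => rew ω 0 + γ * ret γ (restart 1 ω)) := by
    filter_upwards [ae_lt_top (measurable_absRet γ) (hQ x.1 x.2).ne] with ω hω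
      using ret_eq_add_restart hω.ne
  refine ⟨h, ((integrable_ret hQ x).sub (integrable_rew_zero hQ x)).congr ?_⟩
  filter_upwards [h] with ω hω
  simp [hω]

/-- The Bellman equation. -/
lemma bellman (hQ : ∀ s a, ∫⁻ ω, absRet γ ω ∂(trajSA P π (s, a)) < ∞)
    (hV : ∀ s, ∫⁻ ω, absRet γ ω ∂(trajS P π s) < ∞) (x : S × A) :
    Integrable (fun y => y.1.1 + γ * Vval P π γ y.1.2) (stepKernel P π x) ∧
    ∫ y, (y.1.1 + γ * Vval P π γ y.1.2) ∂(stepKernel P π x) = Qval P π γ x.1 x.2 := by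
  obtain ⟨h1, h2⟩ := integrable_restart_one hQ x
  have hr : Integrable (fun y : (ℝ × S) × A => y.1.1) (stepKernel P π x) := by
    rw [← trajSA_map_one, integrable_map_measure
      (Measurable.aestronglyMeasurable (by fun_prop)) (measurable_record 1).aemeasurable]
    exact integrable_rew_zero hQ x
  have hr' : ∫ ω, rew ω 0 ∂(trajSA P π x) = ∫ y, y.1.1 ∂(stepKernel P π x) := by
    rw [← trajSA_map_one, integral_map (measurable_record 1).aemeasurable
      (Measurable.aestronglyMeasurable (by fun_prop))]
    rfl
  have h3 : Integrable (fun ω => γ * ret γ ω) (trajSA P π ∘ₘ pairKernel P π x) := by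
    rw [← trajSA_map_restart_one, integrable_map_measure (by fun_prop) (by fun_prop)]
    exact h2
  -- The Markov property turns the return after time 1 into Q at the next pair; averaging over the
  -- next action turns this into V in `h10`.
  have h4 : ∫ ω, γ * ret γ (restart 1 ω) ∂(trajSA P π x)
      = ∫ z, γ * Qval P π γ z.1 z.2 ∂(pairKernel P π x) := by
    have : ∫ ω, γ * ret γ (restart 1 ω) ∂(trajSA P π x)
      = ∫ ω, γ * ret γ ω ∂((trajSA P π x).map (restart 1)) := by
      rw [integral_map (by fun_prop) (by fun_prop)]
    rw [this, trajSA_map_restart_one, integral_comp_measure h3]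
    simp only [integral_const_mul]
    rfl
  have h5 : Integrable (fun z : S × A => γ * Qval P π γ z.1 z.2) (pairKernel P π x) := by
    refine (Measure.integrable_integral_norm_of_integrable_comp h3).mono (by fun_prop)
      (Filter.Eventually.of_forall fun z => ?_)
    rw [Qval, ← integral_const_mul]
    exact (norm_integral_le_integral_norm _).trans (le_abs_self _)
  have h6 : Integrable (fun y : (ℝ × S) × A => γ * Qval P π γ y.1.2 y.2) (stepKernel P π x) := by
    rw [pairKernel, Kernel.map_apply _ (by fun_prop),
      integrable_map_measure (by fun_prop) (by fun_prop)] at h5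
    exact h5
  have h7 : ∀ y : ℝ × S, ∫ a, γ * Qval P π γ y.2 a ∂(π y.2) = γ * Vval P π γ y.2 := fun y => by
    rw [integral_const_mul, (integrable_Qval_and_integral hV y.2).2]
  have hfst : (stepKernel P π x).map Prod.fst = P x := by
    rw [stepKernel, ← Kernel.map_apply _ (by fun_prop), ← Kernel.fst_eq, Kernel.fst_compProd]
  have h8 : Integrable (fun y : ℝ × S => γ * Vval P π γ y.2) (P x) := by
    have := h6.integral_compProd
    simp only [Kernel.comap_apply, h7] at this
    exact this
  have h9 : Integrable (fun y : (ℝ × S) × A => γ * Vval P π γ y.1.2) (stepKernel P π x) := by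
    rw [← hfst, integrable_map_measure (Measurable.aestronglyMeasurable (by fun_prop))
      (by fun_prop)] at h8
    exact h8
  refine ⟨hr.add h9, ?_⟩
  have h10 : ∫ y, γ * Vval P π γ y.1.2 ∂(stepKernel P π x)
      = ∫ z, γ * Qval P π γ z.1 z.2 ∂(pairKernel P π x) := by
    rw [pairKernel, Kernel.map_apply _ (by fun_prop), integral_map (by fun_prop) (by fun_prop)]
    simp only [pair]
    rw [stepKernel, integral_compProd h6, integral_compProd h9]
    simp [h7]
  rw [integral_add hr h9, h10, ← h4, ← hr', ← integral_add (integrable_rew_zero hQ x) h2, Qval,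
    integral_congr_ae h1]

end UAE

end

/-! ### Conditional means along the trajectory and L² bounds -/

noncomputable section

namespace UAE

variable {S A : Type*} [MeasurableSpace S] [MeasurableSpace A]

/-- The information carried by the records up to time `n`. -/
abbrev histAlg (S A : Type*) [MeasurableSpace S] [MeasurableSpace A] (n : ℕ) :
    MeasurableSpace (Traj S A) :=
  MeasurableSpace.comap (Preorder.frestrictLe (π := fun _ => (ℝ × S) × A) n) inferInstance

/-- The information available when the action at time `n + 1` is chosen. -/
abbrev preActAlg (S A : Type*) [MeasurableSpace S] [MeasurableSpace A] (n : ℕ) :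
    MeasurableSpace (Traj S A) :=
  MeasurableSpace.comap
    (fun ω => (Preorder.frestrictLe (π := fun _ => (ℝ × S) × A) n ω, (ω (n + 1)).1)) inferInstance

lemma measurable_record_histAlg {n i : ℕ} (h : i ≤ n) :
    Measurable[histAlg S A n] fun ω : Traj S A => ω i := by
  have h1 : Measurable fun p : Π _ : Finset.Iic n, (ℝ × S) × A => p ⟨i, Finset.mem_Iic.2 h⟩ := by
    fun_prop
  exact h1.comp (comap_measurable _)

lemma measurable_record_preActAlg {n i : ℕ} (h : i ≤ n) :
    Measurable[preActAlg S A n] fun ω : Traj S A => ω i := by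
  have h1 : Measurable fun p : (Π _ : Finset.Iic n, (ℝ × S) × A) × (ℝ × S) =>
    p.1 ⟨i, Finset.mem_Iic.2 h⟩ := by fun_prop
  exact h1.comp (comap_measurable _)

lemma measurable_record_fst_preActAlg {n i : ℕ} (h : i ≤ n + 1) :
    Measurable[preActAlg S A n] fun ω : Traj S A => (ω i).1 := by
  rcases Nat.le_succ_iff.1 h with h | rfl
  · exact measurable_fst.comp (measurable_record_preActAlg h)
  · have h1 : Measurable fun p : (Π _ : Finset.Iic n, (ℝ × S) × A) × (ℝ × S) => p.2 := by fun_prop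
    exact h1.comp (comap_measurable _)

lemma measurable_pair_histAlg {n i : ℕ} (h : i ≤ n) :
    Measurable[histAlg S A n] fun ω : Traj S A => (st ω i, act ω i) :=
  measurable_pair.comp (measurable_record_histAlg h)

lemma measurable_pair_preActAlg {n i : ℕ} (h : i ≤ n) :
    Measurable[preActAlg S A n] fun ω : Traj S A => (st ω i, act ω i) :=
  measurable_pair.comp (measurable_record_preActAlg h)

lemma measurable_st_preActAlg {n i : ℕ} (h : i ≤ n + 1) :
    Measurable[preActAlg S A n] fun ω : Traj S A => st ω i :=
  measurable_snd.comp (measurable_record_fst_preActAlg h)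

lemma measurable_rew_preActAlg {n i : ℕ} (h : i ≤ n) :
    Measurable[preActAlg S A n] fun ω : Traj S A => rew ω i :=
  measurable_fst.comp (measurable_record_fst_preActAlg (Nat.succ_le_succ h))

/-- The temporal difference `r_n + γ V(s_{n+1}) - V(s_n)`. -/
def td (γ : ℝ) (V : S → ℝ) (ω : Traj S A) (n : ℕ) : ℝ :=
  rew ω n + γ * V (st ω (n + 1)) - V (st ω n)

lemma measurable_td_preActAlg {γ : ℝ} {V : S → ℝ} (hV : Measurable V) {n i : ℕ} (h : i ≤ n) :
    Measurable[preActAlg S A n] fun ω : Traj S A => td γ V ω i := by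
  have h1 := measurable_rew_preActAlg (S := S) (A := A) h
  have h2 := hV.comp (measurable_st_preActAlg (S := S) (A := A) (Nat.succ_le_succ h))
  have h3 := hV.comp (measurable_st_preActAlg (S := S) (A := A) (h.trans n.le_succ))
  exact (h1.add (h2.const_mul γ)).sub h3

@[fun_prop]
lemma measurable_td {γ : ℝ} {V : S → ℝ} (hV : Measurable V) (n : ℕ) :
    Measurable fun ω : Traj S A => td γ V ω n := by
  unfold td; fun_prop

variable {P : Kernel (S × A) (ℝ × S)} [IsMarkovKernel P] {π : Kernel S A} [IsMarkovKernel π]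
  {γ : ℝ} {m : Measure (S × A)} [SFinite m]
  {E : Type*} [NormedAddCommGroup E] [NormedSpace ℝ E] [CompleteSpace E]

/-- Conditioning on the history, as a disintegration: the source of both martingale-type identities
below. -/
lemma integral_trajSA_hist_succ {n : ℕ}
    {F : (Π _ : Finset.Iic n, (ℝ × S) × A) × ((ℝ × S) × A) → E} (hF : StronglyMeasurable F)
    (hi : Integrable (fun ω => F (Preorder.frestrictLe n ω, ω (n + 1))) (trajSA P π ∘ₘ m)) :
    Integrable F (((trajSA P π ∘ₘ m).map (Preorder.frestrictLe n)) ⊗ₘ histKernel P π n) ∧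
    ∫ ω, F (Preorder.frestrictLe n ω, ω (n + 1)) ∂(trajSA P π ∘ₘ m)
      = ∫ h, ∫ y, F (h, y) ∂(stepKernel P π (pair (h ⟨n, Finset.mem_Iic.2 le_rfl⟩)))
          ∂((trajSA P π ∘ₘ m).map (Preorder.frestrictLe n)) := by
  have hm : Measurable fun ω : Traj S A =>
      (Preorder.frestrictLe (π := fun _ => (ℝ × S) × A) n ω, ω (n + 1)) := by fun_prop
  have h1 : Integrable F (((trajSA P π ∘ₘ m).map (Preorder.frestrictLe n)) ⊗ₘ histKernel P π n) := by
    rw [← comp_trajSA_map_hist_succ, integrable_map_measure hF.aestronglyMeasurable hm.aemeasurable]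
    exact hi
  refine ⟨h1, ?_⟩
  rw [← integral_map (f := F) hm.aemeasurable hF.aestronglyMeasurable, comp_trajSA_map_hist_succ,
    Measure.integral_compProd h1]
  rfl

/-- Given the history up to `s_n, a_n`, the temporal difference has mean `Q - V`. -/
lemma integral_td_smul
    (hQ : ∀ s a, ∫⁻ ω, absRet γ ω ∂(trajSA P π (s, a)) < ∞)
    (hV : ∀ s, ∫⁻ ω, absRet γ ω ∂(trajS P π s) < ∞) {n : ℕ} {G : Traj S A → E}
    (hG : StronglyMeasurable[histAlg S A n] G)
    (hi : Integrable (fun ω => td γ (Vval P π γ) ω n • G ω) (trajSA P π ∘ₘ m)) :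
    ∫ ω, td γ (Vval P π γ) ω n • G ω ∂(trajSA P π ∘ₘ m)
      = ∫ ω, adv P π γ (st ω n, act ω n) • G ω ∂(trajSA P π ∘ₘ m) := by
  obtain ⟨g, hg, rfl⟩ := hG.exists_eq_measurable_comp
  let F : (Π _ : Finset.Iic n, (ℝ × S) × A) × ((ℝ × S) × A) → E := fun p =>
    (p.2.1.1 + γ * Vval P π γ p.2.1.2 - Vval P π γ (p.1 ⟨n, Finset.mem_Iic.2 le_rfl⟩).1.2) • g p.1
  have hF : StronglyMeasurable F :=
    (Measurable.stronglyMeasurable (by fun_prop)).smul (hg.comp_measurable measurable_fst)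
  have h1 := (integral_trajSA_hist_succ (P := P) (π := π) (m := m) hF hi).2
  have h2 : ∀ h : (Π _ : Finset.Iic n, (ℝ × S) × A),
      ∫ y, F (h, y) ∂(stepKernel P π (pair (h ⟨n, Finset.mem_Iic.2 le_rfl⟩)))
        = adv P π γ (pair (h ⟨n, Finset.mem_Iic.2 le_rfl⟩)) • g h := by
    intro h
    simp only [F]
    obtain ⟨hb1, hb2⟩ := bellman hQ hV (pair (h ⟨n, Finset.mem_Iic.2 le_rfl⟩))
    rw [integral_smul_const, integral_sub hb1 (integrable_const _), hb2]
    simp [adv, pair]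
  have h3 : StronglyMeasurable fun h : (Π _ : Finset.Iic n, (ℝ × S) × A) =>
      adv P π γ (pair (h ⟨n, Finset.mem_Iic.2 le_rfl⟩)) • g h :=
    (Measurable.stronglyMeasurable (by fun_prop)).smul hg
  simp only [h2] at h1
  rw [integral_map (by fun_prop) h3.aestronglyMeasurable] at h1
  exact h1

/-- The advantage at time `n + 1` is centred given `s_{n+1}` and the past. -/
lemma integral_adv_smul
    (hV : ∀ s, ∫⁻ ω, absRet γ ω ∂(trajS P π s) < ∞) {n : ℕ} {G : Traj S A → E}
    (hG : StronglyMeasurable[preActAlg S A n] G)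
    (hi : Integrable (fun ω => adv P π γ (st ω (n + 1), act ω (n + 1)) • G ω) (trajSA P π ∘ₘ m)) :
    ∫ ω, adv P π γ (st ω (n + 1), act ω (n + 1)) • G ω ∂(trajSA P π ∘ₘ m) = 0 := by
  obtain ⟨g, hg, rfl⟩ := hG.exists_eq_measurable_comp
  let F : (Π _ : Finset.Iic n, (ℝ × S) × A) × ((ℝ × S) × A) → E := fun p =>
    adv P π γ (pair p.2) • g (p.1, p.2.1)
  have hF : StronglyMeasurable F :=
    (Measurable.stronglyMeasurable (by fun_prop)).smul (hg.comp_measurable (by fun_prop))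
  have h1 := (integral_trajSA_hist_succ (P := P) (π := π) (m := m) hF hi).2
  refine h1.trans ?_
  refine integral_eq_zero_of_ae (Filter.Eventually.of_forall fun h => ?_)
  simp only [Pi.zero_apply]
  -- Where the section is not integrable its Bochner integral is 0 by convention, which is the
  -- desired value anyway.
  by_cases hint : Integrable (fun y => F (h, y))
      (stepKernel P π (pair (h ⟨n, Finset.mem_Iic.2 le_rfl⟩)))
  · rw [stepKernel, integral_compProd hint]
    refine integral_eq_zero_of_ae (Filter.Eventually.of_forall fun y => ?_)
    simp only [F, pair, integral_smul_const, Kernel.comap_apply, integral_adv hV, zero_smul,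
      Pi.zero_apply]
  · exact integral_undef hint

lemma comp_trajSA_map_pair (n : ℕ) :
    (trajSA P π ∘ₘ m).map (fun ω => (st ω n, act ω n)) = pairLaw P π m n := by
  have h : (fun ω : Traj S A => (st ω n, act ω n)) = (fun ω => pair (ω 0)) ∘ restart n := rfl
  have h2 : (trajSA P π).map (fun ω => pair (ω 0)) = Kernel.id := by
    ext x : 1
    have h3 : (fun ω : Traj S A => pair (ω 0)) = pair ∘ fun ω : Traj S A => ω 0 := rfl
    rw [Kernel.map_apply _ (by fun_prop), h3, ← Measure.map_map (by fun_prop)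
      (measurable_record 0), trajSA_map_zero, Measure.map_dirac' (by fun_prop), Kernel.id_apply]
    rfl
  rw [h, ← Measure.map_map (by fun_prop) (by fun_prop), comp_trajSA_map_restart,
    Measure.map_comp _ _ (by fun_prop), h2, Measure.id_comp]

/-- After one step the action follows π given the state, whatever the initial law m, so V becomes a
conditional mean of Q from time 1 on. -/
lemma pairKernel_comp : pairKernel P π ∘ₘ m = (P.snd ∘ₘ m) ⊗ₘ π := by
  refine Measure.ext_of_lintegral _ fun f hf => ?_
  rw [Measure.lintegral_bind (Kernel.aemeasurable _) hf.aemeasurable,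
    Measure.lintegral_compProd hf, Measure.lintegral_bind (Kernel.aemeasurable _)
      (Measurable.aemeasurable (by fun_prop))]
  refine lintegral_congr fun x => ?_
  rw [pairKernel, Kernel.map_apply _ (by fun_prop), lintegral_map hf (by fun_prop), stepKernel,
    Kernel.lintegral_compProd _ _ _ (by fun_prop), Kernel.snd_apply,
    lintegral_map (by fun_prop) (by fun_prop)]
  rfl

/-- Q at time n is the conditional mean of the return from n on, so L² contraction and Minkowski's
inequality bound it by ∑ γ^k C. -/
lemma eLpNorm_Qval_le (hγ₀ : 0 ≤ γ) (hγ₁ : γ < 1) {C : ℝ≥0}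
    (hr : ∀ k, eLpNorm (fun ω => rew ω k) 2 (trajSA P π ∘ₘ m) ≤ C)
    (n : ℕ) :
    eLpNorm (fun ω => Qval P π γ (st ω n) (act ω n)) 2 (trajSA P π ∘ₘ m)
      ≤ ENNReal.ofReal (1 - γ)⁻¹ * C := by
  have h1 : eLpNorm (fun ω => Qval P π γ (st ω n) (act ω n)) 2 (trajSA P π ∘ₘ m)
      = eLpNorm (fun x : S × A => Qval P π γ x.1 x.2) 2 (pairLaw P π m n) := by
    rw [← comp_trajSA_map_pair, eLpNorm_map_measure (by fun_prop) (by fun_prop)]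
    rfl
  have h2 : ∀ k, eLpNorm (fun ω => rew ω k) 2 (trajSA P π ∘ₘ pairLaw P π m n) ≤ C := fun k => by
    rw [← comp_trajSA_map_restart, eLpNorm_map_measure (by fun_prop) (by fun_prop)]
    simpa [Function.comp_def] using hr (n + k)
  have h3 := tsum_eLpNorm_geometric_le hγ₀ hγ₁ h2
  have h4 : ∀ k, MemLp (fun ω => rew ω k) 2 (trajSA P π ∘ₘ pairLaw P π m n) := fun k =>
    ⟨(measurable_rew k).aestronglyMeasurable, lt_of_le_of_lt (h2 k) ENNReal.coe_lt_top⟩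
  simp only [smul_eq_mul] at h3
  have h5 : ∀ k, MemLp (fun ω => γ ^ k * rew ω k) 2 (trajSA P π ∘ₘ pairLaw P π m n) := fun k =>
    (h4 k).const_mul _
  have h6 := (memLp_tsum_of_tsum_eLpNorm_ne_top h5
    (ne_top_of_le_ne_top (ENNReal.mul_ne_top ENNReal.ofReal_ne_top ENNReal.coe_ne_top) h3)).2
  rw [h1]
  exact (eLpNorm_integral_kernel_le (trajSA P π) _
    (measurable_ret γ).stronglyMeasurable).trans (h6.trans h3)

/-- At a positive time V is the conditional mean of Q given the state, and the bound for Q is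
inherited. This fails at time 0, where a_0 need not follow π. -/
lemma eLpNorm_Vval_le (hγ₀ : 0 ≤ γ) (hγ₁ : γ < 1) {C : ℝ≥0}
    (hr : ∀ k, eLpNorm (fun ω => rew ω k) 2 (trajSA P π ∘ₘ m) ≤ C)
    (hV : ∀ s, ∫⁻ ω, absRet γ ω ∂(trajS P π s) < ∞) (n : ℕ) :
    eLpNorm (fun ω => Vval P π γ (st ω (n + 1))) 2 (trajSA P π ∘ₘ m)
      ≤ ENNReal.ofReal (1 - γ)⁻¹ * C := by
  refine le_trans ?_ (eLpNorm_Qval_le hγ₀ hγ₁ hr (n + 1))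
  have h1 : pairLaw P π m (n + 1) = (P.snd ∘ₘ pairLaw P π m n) ⊗ₘ π := by
    rw [pairLaw, pairKernel_comp]
  have h2 : eLpNorm (fun ω => Qval P π γ (st ω (n + 1)) (act ω (n + 1))) 2 (trajSA P π ∘ₘ m)
      = eLpNorm (fun x : S × A => Qval P π γ x.1 x.2) 2 (pairLaw P π m (n + 1)) := by
    rw [← comp_trajSA_map_pair, eLpNorm_map_measure (by fun_prop) (by fun_prop)]
    rfl
  have h3 : eLpNorm (fun ω => Vval P π γ (st ω (n + 1))) 2 (trajSA P π ∘ₘ m)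
      = eLpNorm (fun s : S => Vval P π γ s) 2 (P.snd ∘ₘ pairLaw P π m n) := by
    have h4 : (fun ω : Traj S A => Vval P π γ (st ω (n + 1)))
      = (fun x : S × A => Vval P π γ x.1) ∘ fun ω : Traj S A => (st ω (n + 1), act ω (n + 1)) := rfl
    rw [h4, ← eLpNorm_map_measure (Measurable.aestronglyMeasurable (by fun_prop)) (by fun_prop),
      comp_trajSA_map_pair, h1]
    conv_rhs => rw [← Measure.fst_compProd (P.snd ∘ₘ pairLaw P π m n) π]
    rw [Measure.fst, eLpNorm_map_measure (Measurable.aestronglyMeasurable (by fun_prop))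
      (by fun_prop)]
    rfl
  have h5 : ∀ s, Vval P π γ s = ∫ x, Qval P π γ x.1 x.2 ∂((Kernel.id ×ₖ π) s) := fun s => by
    rw [Kernel.prod_apply, Kernel.id_apply, Measure.dirac_prod,
      integral_map (by fun_prop) (by fun_prop), (integrable_Qval_and_integral hV s).2]
  rw [h2, h3, h1, Measure.compProd_eq_comp_prod]
  simp only [h5]
  exact eLpNorm_integral_kernel_le _ _ (measurable_Qval P π γ).stronglyMeasurable

end UAE

end

/-! ### The unified estimator as a perturbation of the generalized one -/

noncomputable section

namespace UAE

variable {S A : Type*} [MeasurableSpace S] [MeasurableSpace A]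

lemma gaeTerm_eq (γ lam : ℝ) (V : S → ℝ) (t : ℕ) (ω : Traj S A) (l : ℕ) :
    gaeTerm γ lam V t ω l = (γ * lam) ^ l * td γ V ω (t + l) := rfl

lemma gaeTerm_restart (γ lam : ℝ) (V : S → ℝ) (t : ℕ) (ω : Traj S A) (l : ℕ) :
    gaeTerm γ lam V 0 (restart t ω) l = gaeTerm γ lam V t ω l := by
  simp [gaeTerm, add_assoc]

lemma gae_restart (γ lam : ℝ) (V : S → ℝ) (t : ℕ) (ω : Traj S A) :
    gae γ lam V 0 (restart t ω) = gae γ lam V t ω := by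
  simp [gae, gaeTerm_restart]

lemma uaeTerm_restart (γ lam : ℝ) (Ψ : S → A → ℝ) (b : S → ℝ) (t : ℕ) (ω : Traj S A) (l : ℕ) :
    uaeTerm γ lam Ψ b 0 (restart t ω) l = uaeTerm γ lam Ψ b t ω l := by
  simp [uaeTerm, resid, corr, add_assoc]

lemma uae_restart (γ lam : ℝ) (Ψ : S → A → ℝ) (b : S → ℝ) (t : ℕ) (ω : Traj S A) :
    uae γ lam Ψ b 0 (restart t ω) = uae γ lam Ψ b t ω := by
  simp [uae, uaeTerm_restart, resid]

@[fun_prop]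
lemma measurable_gae {γ lam : ℝ} {V : S → ℝ} (hV : Measurable V) (t : ℕ) :
    Measurable fun ω : Traj S A => gae γ lam V t ω :=
  measurable_real_tsum fun l => by unfold gaeTerm; fun_prop

@[fun_prop]
lemma measurable_uae {γ lam : ℝ} {Ψ : S → A → ℝ} {b : S → ℝ}
    (hΨ : Measurable (Function.uncurry Ψ)) (hb : Measurable b) (t : ℕ) :
    Measurable fun ω : Traj S A => uae γ lam Ψ b t ω := by
  have h : ∀ n, Measurable fun ω : Traj S A => Ψ (st ω n) (act ω n) := fun n =>
    hΨ.comp ((measurable_st n).prodMk (measurable_act n))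
  have h1 : ∀ n, Measurable fun ω : Traj S A => resid γ Ψ b ω n := fun n => by
    unfold resid; have := h (n + 1); fun_prop
  have h2 : ∀ n, Measurable fun ω : Traj S A => corr Ψ b ω n := fun n => by
    unfold corr; have := h n; fun_prop
  exact (h1 t).add (measurable_real_tsum fun l => by
    unfold uaeTerm; have := h1 (t + (l + 1)); have := h2 (t + (l + 1)); fun_prop)

/-- The unified estimator bootstrapped with `V + D` differs from the generalized one by the change
of baseline and a discounted sum of the values of `D`. -/
lemma uae_eq_gae_add {γ lam : ℝ} {V b : S → ℝ} {D : S → A → ℝ} {Ψ : S → A → ℝ}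
    (hΨ : ∀ s a, Ψ s a = V s + D s a) {ω : Traj S A}
    (h1 : Summable fun l => gaeTerm γ lam V 0 ω l)
    (h2 : Summable fun l => (γ * lam) ^ l * D (st ω (l + 1)) (act ω (l + 1))) :
    (Summable fun l => uaeTerm γ lam Ψ b 0 ω (l + 1)) ∧
    uae γ lam Ψ b 0 ω = gae γ lam V 0 ω + (V (st ω 0) - b (st ω 0))
      + γ * (1 - lam) * ∑' l, (γ * lam) ^ l * D (st ω (l + 1)) (act ω (l + 1)) := by
  -- In δ - z the baseline cancels and Ψ = V + D leaves the temporal difference plus γ times the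
  -- next D minus the current D. The two D-sums differ by an index shift; the missing first term
  -- comes from δ_0, leaving the factor γ - γλ.
  have h3 : ∀ l, uaeTerm γ lam Ψ b 0 ω (l + 1) = gaeTerm γ lam V 0 ω (l + 1)
      + γ * ((γ * lam) ^ (l + 1) * D (st ω (l + 1 + 1)) (act ω (l + 1 + 1)))
      - γ * lam * ((γ * lam) ^ l * D (st ω (l + 1)) (act ω (l + 1))) := fun l => by
    simp only [uaeTerm, resid, corr, gaeTerm, hΨ, zero_add]
    ring
  have h4 := (summable_nat_add_iff 1).2 h1
  have h5 := (summable_nat_add_iff 1).2 h2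
  refine ⟨?_, ?_⟩
  · simp only [h3]
    exact (h4.add (h5.mul_left γ)).sub (h2.mul_left _)
  · rw [uae, gae]
    simp only [h3]
    rw [(h4.add (h5.mul_left γ)).tsum_sub (h2.mul_left _), h4.tsum_add (h5.mul_left γ),
      tsum_mul_left, tsum_mul_left, h1.tsum_eq_zero_add, h2.tsum_eq_zero_add]
    simp only [resid, gaeTerm, hΨ, zero_add, pow_zero, one_mul]
    ring

variable {P : Kernel (S × A) (ℝ × S)} [IsMarkovKernel P] {π : Kernel S A} [IsMarkovKernel π]
  {γ : ℝ} {m : Measure (S × A)} [SFinite m]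

lemma exists_eLpNorm_td_adv_le (hγ₀ : 0 ≤ γ) (hγ₁ : γ < 1)
    (hV : ∀ s, ∫⁻ ω, absRet γ ω ∂(trajS P π s) < ∞) {C : ℝ≥0}
    (hr : ∀ k, eLpNorm (fun ω => rew ω k) 2 (trajSA P π ∘ₘ m) ≤ C)
    (hV2 : MemLp (fun ω => Vval P π γ (st ω 0)) 2 (trajSA P π ∘ₘ m)) :
    ∃ B : ℝ≥0, (∀ n, eLpNorm (fun ω => td γ (Vval P π γ) ω n) 2 (trajSA P π ∘ₘ m) ≤ B) ∧
      ∀ n, eLpNorm (fun ω => adv P π γ (st ω n, act ω n)) 2 (trajSA P π ∘ₘ m) ≤ B := by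
  set μ := trajSA P π ∘ₘ m
  set C' : ℝ≥0∞ := ENNReal.ofReal (1 - γ)⁻¹ * C
  have hC' : C' ≠ ∞ := ENNReal.mul_ne_top ENNReal.ofReal_ne_top ENNReal.coe_ne_top
  set K : ℝ≥0∞ := C' + eLpNorm (fun ω => Vval P π γ (st ω 0)) 2 μ
  have hK : K ≠ ∞ := ENNReal.add_ne_top.2 ⟨hC', hV2.2.ne⟩
  have hv : ∀ n, eLpNorm (fun ω => Vval P π γ (st ω n)) 2 μ ≤ K := by
    -- Time 0 needs the assumption on V(s_0); later times follow from the rewards.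
    rintro (_ | n)
    · exact le_add_self
    · exact (eLpNorm_Vval_le hγ₀ hγ₁ hr hV n).trans le_self_add
  have hq : ∀ n, eLpNorm (fun ω => Qval P π γ (st ω n) (act ω n)) 2 μ ≤ C' :=
    eLpNorm_Qval_le hγ₀ hγ₁ hr
  have hvm : ∀ n, AEStronglyMeasurable (fun ω : Traj S A => Vval P π γ (st ω n)) μ := fun n =>
    Measurable.aestronglyMeasurable (by fun_prop)
  have hqm : ∀ n, AEStronglyMeasurable (fun ω : Traj S A => Qval P π γ (st ω n) (act ω n)) μ :=
    fun n => ((measurable_Qval P π γ).comp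
      ((measurable_st n).prodMk (measurable_act n))).aestronglyMeasurable
  have htd : ∀ n, eLpNorm (fun ω => td γ (Vval P π γ) ω n) 2 μ ≤ C + ‖γ‖ₑ * K + K := by
    intro n
    have h1 : eLpNorm (fun ω => γ * Vval P π γ (st ω (n + 1))) 2 μ ≤ ‖γ‖ₑ * K :=
      (eLpNorm_const_smul_le (c := γ) (f := fun ω => Vval P π γ (st ω (n + 1)))).trans
        (by gcongr; exact hv _)
    have h2 : eLpNorm (fun ω => rew ω n + γ * Vval P π γ (st ω (n + 1))) 2 μ ≤ C + ‖γ‖ₑ * K :=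
      (eLpNorm_add_le (measurable_rew n).aestronglyMeasurable ((hvm _).const_mul γ)
        (by norm_num)).trans (add_le_add (hr n) h1)
    exact (eLpNorm_sub_le ((measurable_rew n).aestronglyMeasurable.add ((hvm _).const_mul γ))
      (hvm n) (by norm_num)).trans (add_le_add h2 (hv n))
  have hadv : ∀ n, eLpNorm (fun ω => adv P π γ (st ω n, act ω n)) 2 μ ≤ C' + K := fun n =>
    (eLpNorm_sub_le (hqm n) (hvm n) (by norm_num)).trans (add_le_add (hq n) (hv n))
  have hB : (C + ‖γ‖ₑ * K + K) + (C' + K) ≠ ∞ := by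
    have : ‖γ‖ₑ ≠ ∞ := enorm_ne_top
    finiteness
  refine ⟨((C + ‖γ‖ₑ * K + K) + (C' + K)).toNNReal, fun n => ?_, fun n => ?_⟩
  · rw [ENNReal.coe_toNNReal hB]; exact (htd n).trans le_self_add
  · rw [ENNReal.coe_toNNReal hB]; exact (hadv n).trans le_add_self

end UAE

end

/-! ### Orthogonality relations -/

noncomputable section

namespace UAE

variable {S A : Type*} [MeasurableSpace S] [MeasurableSpace A]
  {P : Kernel (S × A) (ℝ × S)} [IsMarkovKernel P] {π : Kernel S A} [IsMarkovKernel π]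
  {γ : ℝ} {m : Measure (S × A)} [SFinite m]

lemma integral_adv_mul_eq_zero (hV : ∀ s, ∫⁻ ω, absRet γ ω ∂(trajS P π s) < ∞)
    (hadv : ∀ n, MemLp (fun ω => adv P π γ (st ω n, act ω n)) 2 (trajSA P π ∘ₘ m))
    {n : ℕ} {G : Traj S A → ℝ} (hG : Measurable[preActAlg S A n] G)
    (hG2 : MemLp G 2 (trajSA P π ∘ₘ m)) :
    ∫ ω, adv P π γ (st ω (n + 1), act ω (n + 1)) * G ω ∂(trajSA P π ∘ₘ m) = 0 :=
  integral_adv_smul hV hG.stronglyMeasurable ((hadv (n + 1)).integrable_mul hG2)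

lemma integral_td_mul (hQ : ∀ s a, ∫⁻ ω, absRet γ ω ∂(trajSA P π (s, a)) < ∞)
    (hV : ∀ s, ∫⁻ ω, absRet γ ω ∂(trajS P π s) < ∞)
    (htd : ∀ n, MemLp (fun ω => td γ (Vval P π γ) ω n) 2 (trajSA P π ∘ₘ m))
    {n : ℕ} {G : Traj S A → ℝ} (hG : Measurable[histAlg S A n] G)
    (hG2 : MemLp G 2 (trajSA P π ∘ₘ m)) :
    ∫ ω, td γ (Vval P π γ) ω n * G ω ∂(trajSA P π ∘ₘ m)
      = ∫ ω, adv P π γ (st ω n, act ω n) * G ω ∂(trajSA P π ∘ₘ m) :=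
  integral_td_smul hQ hV hG.stronglyMeasurable ((htd n).integrable_mul hG2)

lemma integral_adv_mul_adv (hV : ∀ s, ∫⁻ ω, absRet γ ω ∂(trajS P π s) < ∞)
    (hadv : ∀ n, MemLp (fun ω => adv P π γ (st ω n, act ω n)) 2 (trajSA P π ∘ₘ m))
    {i j : ℕ} (h : i < j) :
    ∫ ω, adv P π γ (st ω j, act ω j) * adv P π γ (st ω i, act ω i) ∂(trajSA P π ∘ₘ m) = 0 := by
  obtain ⟨n, rfl⟩ : ∃ n, j = n + 1 := ⟨j - 1, by omega⟩
  exact integral_adv_mul_eq_zero hV hadv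
    ((measurable_adv P π γ).comp (measurable_pair_preActAlg (by omega))) (hadv i)

/-- For j > l, conditioning on the history up to (s_j, a_j) replaces `td`_j by `adv`_j, and distinct
advantages are orthogonal. For j ≤ l, `td`_j is known before a_{l+1} is drawn, given which
`adv`_{l+1} is centred. -/
lemma integral_adv_mul_td (hQ : ∀ s a, ∫⁻ ω, absRet γ ω ∂(trajSA P π (s, a)) < ∞)
    (hV : ∀ s, ∫⁻ ω, absRet γ ω ∂(trajS P π s) < ∞)
    (htd : ∀ n, MemLp (fun ω => td γ (Vval P π γ) ω n) 2 (trajSA P π ∘ₘ m))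
    (hadv : ∀ n, MemLp (fun ω => adv P π γ (st ω n, act ω n)) 2 (trajSA P π ∘ₘ m)) (l j : ℕ) :
    ∫ ω, adv P π γ (st ω (l + 1), act ω (l + 1)) * td γ (Vval P π γ) ω j ∂(trajSA P π ∘ₘ m)
      = if j = l + 1 then
        ∫ ω, adv P π γ (st ω (l + 1), act ω (l + 1)) ^ 2 ∂(trajSA P π ∘ₘ m) else 0 := by
  rcases Nat.lt_or_ge l j with h | h
  · have h1 := integral_td_mul hQ hV htd (G := fun ω => adv P π γ (st ω (l + 1), act ω (l + 1)))
      ((measurable_adv P π γ).comp (measurable_pair_histAlg (n := j) (by omega))) (hadv (l + 1))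
    simp only [mul_comm (adv P π γ _) (td _ _ _ _)]
    rw [h1]
    split_ifs with hj
    · subst hj; simp only [sq]
    · exact integral_adv_mul_adv hV hadv (by omega)
  · rw [if_neg (by omega)]
    exact integral_adv_mul_eq_zero hV hadv (measurable_td_preActAlg (measurable_Vval P π γ) h)
      (htd j)

/-- Second moments of the generalized estimator and of the discounted sum of advantages. -/
lemma hasSum_second_moments (hQ : ∀ s a, ∫⁻ ω, absRet γ ω ∂(trajSA P π (s, a)) < ∞)
    (hV : ∀ s, ∫⁻ ω, absRet γ ω ∂(trajS P π s) < ∞)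
    (htd : ∀ n, MemLp (fun ω => td γ (Vval P π γ) ω n) 2 (trajSA P π ∘ₘ m))
    (hadv : ∀ n, MemLp (fun ω => adv P π γ (st ω n, act ω n)) 2 (trajSA P π ∘ₘ m))
    {κ : ℝ}
    (hs1 : ∑' n, eLpNorm (fun ω => κ ^ n • td γ (Vval P π γ) ω n) 2 (trajSA P π ∘ₘ m) ≠ ∞)
    (hs2 : ∑' n, eLpNorm (fun ω => κ ^ n • adv P π γ (st ω (n + 1), act ω (n + 1))) 2
      (trajSA P π ∘ₘ m) ≠ ∞) :
    HasSum (fun l => κ ^ (2 * l) * κ *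
        ∫ ω, adv P π γ (st ω (l + 1), act ω (l + 1)) ^ 2 ∂(trajSA P π ∘ₘ m))
      (∫ ω, (∑' l, κ ^ l * td γ (Vval P π γ) ω l) *
        (∑' l, κ ^ l * adv P π γ (st ω (l + 1), act ω (l + 1))) ∂(trajSA P π ∘ₘ m)) ∧
    HasSum (fun l => κ ^ (2 * l) *
        ∫ ω, adv P π γ (st ω (l + 1), act ω (l + 1)) ^ 2 ∂(trajSA P π ∘ₘ m))
      (∫ ω, (∑' l, κ ^ l * adv P π γ (st ω (l + 1), act ω (l + 1))) *
        (∑' l, κ ^ l * adv P π γ (st ω (l + 1), act ω (l + 1))) ∂(trajSA P π ∘ₘ m)) := by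
  have hf1 : ∀ n, MemLp (fun ω => κ ^ n • td γ (Vval P π γ) ω n) 2 (trajSA P π ∘ₘ m) :=
    fun n => (htd n).const_mul _
  have hf2 : ∀ n, MemLp (fun ω => κ ^ n • adv P π γ (st ω (n + 1), act ω (n + 1))) 2
      (trajSA P π ∘ₘ m) := fun n => (hadv (n + 1)).const_mul _
  have hA := (memLp_tsum_of_tsum_eLpNorm_ne_top hf1 hs1).1
  have hM := (memLp_tsum_of_tsum_eLpNorm_ne_top hf2 hs2).1
  have hAd : ∀ l, ∫ ω, (∑' j, κ ^ j * td γ (Vval P π γ) ω j) *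
      adv P π γ (st ω (l + 1), act ω (l + 1)) ∂(trajSA P π ∘ₘ m)
      = κ ^ (l + 1) *
        ∫ ω, adv P π γ (st ω (l + 1), act ω (l + 1)) ^ 2 ∂(trajSA P π ∘ₘ m) := by
    intro l
    have h1 := hasSum_integral_smul_of_tsum_eLpNorm_ne_top hf1 hs1 (hadv (l + 1))
    simp only [smul_eq_mul, mul_left_comm _ (κ ^ _), integral_const_mul,
      integral_adv_mul_td hQ hV htd hadv] at h1
    -- Only j = l + 1 survives; this index is one more than in `hMd`, whence the extra factor κ in
    -- the mixed moment.
    have h2 := h1.unique (hasSum_single (l + 1) fun j hj => by simp [hj])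
    simp only [mul_comm (tsum _)]
    simpa using h2
  have hMd : ∀ l, ∫ ω, (∑' j, κ ^ j * adv P π γ (st ω (j + 1), act ω (j + 1))) *
      adv P π γ (st ω (l + 1), act ω (l + 1)) ∂(trajSA P π ∘ₘ m)
      = κ ^ l *
        ∫ ω, adv P π γ (st ω (l + 1), act ω (l + 1)) ^ 2 ∂(trajSA P π ∘ₘ m) := by
    intro l
    have h1 := hasSum_integral_smul_of_tsum_eLpNorm_ne_top hf2 hs2 (hadv (l + 1))
    simp only [smul_eq_mul, mul_left_comm _ (κ ^ _), integral_const_mul] at h1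
    have h2 := h1.unique (hasSum_single l fun j hj => by
      rcases Nat.lt_or_gt_of_ne hj with h | h
      · rw [integral_adv_mul_adv hV hadv (by omega), mul_zero]
      · simp only [mul_comm (adv P π γ (st _ (l + 1), _))]
        rw [integral_adv_mul_adv hV hadv (by omega), mul_zero])
    simp only [mul_comm (tsum _)]
    simpa only [sq] using h2
  constructor
  · have h1 := hasSum_integral_smul_of_tsum_eLpNorm_ne_top hf2 hs2 hA
    simp only [smul_eq_mul, mul_left_comm _ (κ ^ _), integral_const_mul] at h1
    simp only [hAd] at h1
    refine hasSum_of_forall_eq (fun l => ?_) h1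
    ring
  · have h1 := hasSum_integral_smul_of_tsum_eLpNorm_ne_top hf2 hs2 hM
    simp only [smul_eq_mul, mul_left_comm _ (κ ^ _), integral_const_mul] at h1
    simp only [hMd] at h1
    refine hasSum_of_forall_eq (fun l => ?_) h1
    ring

/-- First-order terms: a function of the initial state is correlated with the generalized
estimator only through the initial advantage, and not at all with later advantages. -/
lemma integral_baseline_mul (hQ : ∀ s a, ∫⁻ ω, absRet γ ω ∂(trajSA P π (s, a)) < ∞)
    (hV : ∀ s, ∫⁻ ω, absRet γ ω ∂(trajS P π s) < ∞)
    (htd : ∀ n, MemLp (fun ω => td γ (Vval P π γ) ω n) 2 (trajSA P π ∘ₘ m))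
    (hadv : ∀ n, MemLp (fun ω => adv P π γ (st ω n, act ω n)) 2 (trajSA P π ∘ₘ m))
    {κ : ℝ}
    (hs1 : ∑' n, eLpNorm (fun ω => κ ^ n • td γ (Vval P π γ) ω n) 2 (trajSA P π ∘ₘ m) ≠ ∞)
    (hs2 : ∑' n, eLpNorm (fun ω => κ ^ n • adv P π γ (st ω (n + 1), act ω (n + 1))) 2
      (trajSA P π ∘ₘ m) ≠ ∞) {c : S → ℝ} (hc : Measurable c)
    (hc2 : MemLp (fun ω => c (st ω 0)) 2 (trajSA P π ∘ₘ m)) :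
    ∫ ω, c (st ω 0) * (∑' l, κ ^ l * td γ (Vval P π γ) ω l) ∂(trajSA P π ∘ₘ m)
      = ∫ ω, c (st ω 0) * adv P π γ (st ω 0, act ω 0) ∂(trajSA P π ∘ₘ m) ∧
    ∫ ω, c (st ω 0) * (∑' l, κ ^ l * adv P π γ (st ω (l + 1), act ω (l + 1)))
      ∂(trajSA P π ∘ₘ m) = 0 := by
  have hf1 : ∀ n, MemLp (fun ω => κ ^ n • td γ (Vval P π γ) ω n) 2 (trajSA P π ∘ₘ m) :=
    fun n => (htd n).const_mul _
  have hf2 : ∀ n, MemLp (fun ω => κ ^ n • adv P π γ (st ω (n + 1), act ω (n + 1))) 2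
      (trajSA P π ∘ₘ m) := fun n => (hadv (n + 1)).const_mul _
  have hz : ∀ n, ∫ ω, c (st ω 0) * adv P π γ (st ω (n + 1), act ω (n + 1)) ∂(trajSA P π ∘ₘ m)
      = 0 := fun n => by
    simp only [mul_comm (c _)]
    exact integral_adv_mul_eq_zero hV hadv (hc.comp (measurable_st_preActAlg (by omega))) hc2
  have ht : ∀ n, ∫ ω, c (st ω 0) * td γ (Vval P π γ) ω n ∂(trajSA P π ∘ₘ m)
      = ∫ ω, c (st ω 0) * adv P π γ (st ω n, act ω n) ∂(trajSA P π ∘ₘ m) := fun n => by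
    simp only [mul_comm (c _)]
    exact integral_td_mul hQ hV htd (G := fun ω => c (st ω 0))
      ((hc.comp measurable_fst).comp (measurable_pair_histAlg (n := n) (i := 0) (by omega))) hc2
  constructor
  · have h1 := hasSum_integral_smul_of_tsum_eLpNorm_ne_top hf1 hs1 hc2
    simp only [smul_eq_mul, mul_left_comm _ (κ ^ _), integral_const_mul, ht] at h1
    have h2 := h1.unique (hasSum_single 0 fun j hj => by
      obtain ⟨n, rfl⟩ := Nat.exists_eq_succ_of_ne_zero hj
      rw [hz, mul_zero])
    simpa using h2
  · have h1 := hasSum_integral_smul_of_tsum_eLpNorm_ne_top hf2 hs2 hc2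
    simp only [smul_eq_mul, mul_left_comm _ (κ ^ _), integral_const_mul, hz, mul_zero] at h1
    exact h1.unique hasSum_zero

end UAE

end

/-! ### Second moments at time 0 -/

noncomputable section

namespace UAE

variable {S A : Type*} [MeasurableSpace S] [MeasurableSpace A]
  {P : Kernel (S × A) (ℝ × S)} [IsMarkovKernel P] {π : Kernel S A} [IsMarkovKernel π]
  {γ : ℝ} {m : Measure (S × A)} [SFinite m]

lemma map_pair_zero : (trajSA P π ∘ₘ m).map (fun ω => (st ω 0, act ω 0)) = m :=
  comp_trajSA_map_pair 0

/-- A series of nonnegative functionals of the trajectory may be integrated by conditioning on the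
initial state and action. -/
lemma integral_tsum_conditional {h : ℕ → Traj S A → ℝ} (hm : ∀ l, Measurable (h l))
    (h0 : ∀ l ω, 0 ≤ h l ω) (hi : ∀ l, Integrable (h l) (trajSA P π ∘ₘ m)) {a : ℕ → ℝ}
    (ha : ∀ l, 0 ≤ a l) {T : ℝ} (hT : HasSum (fun l => a l * ∫ ω, h l ω ∂(trajSA P π ∘ₘ m)) T) :
    (∀ᵐ ω ∂(trajSA P π ∘ₘ m), (∀ l, Integrable (h l) (trajSA P π (st ω 0, act ω 0))) ∧
      Summable fun l => a l * ∫ ω', h l ω' ∂(trajSA P π (st ω 0, act ω 0))) ∧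
    Integrable (fun ω => ∑' l, a l * ∫ ω', h l ω' ∂(trajSA P π (st ω 0, act ω 0)))
      (trajSA P π ∘ₘ m) ∧
    ∫ ω, (∑' l, a l * ∫ ω', h l ω' ∂(trajSA P π (st ω 0, act ω 0))) ∂(trajSA P π ∘ₘ m) = T := by
  have hx : Measurable fun ω : Traj S A => (st ω 0, act ω 0) := by fun_prop
  let F : ℕ → S × A → ℝ := fun l x => a l * ∫ ω', h l ω' ∂(trajSA P π x)
  have hFm : ∀ l, Measurable (F l) := fun l =>
    ((hm l).stronglyMeasurable.integral_kernel (κ := trajSA P π)).measurable.const_mul _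
  have hF0 : ∀ l x, 0 ≤ F l x := fun l x => mul_nonneg (ha l) (integral_nonneg (h0 l))
  have hF1 : ∀ l, Integrable (F l) m := fun l => by
    have h1 := Measure.integrable_integral_norm_of_integrable_comp (hi l)
    simp only [Real.norm_of_nonneg (h0 l _)] at h1
    exact h1.const_mul _
  have hF2 : ∀ l, ∫ x, F l x ∂m = a l * ∫ ω, h l ω ∂(trajSA P π ∘ₘ m) := fun l => by
    rw [integral_const_mul, integral_comp_measure (hi l)]
  have hF3 : Summable fun l => ∫ x, ‖F l x‖ ∂m := by
    simp only [Real.norm_of_nonneg (hF0 _ _), hF2]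
    exact hT.summable
  have hF4 : ∑' l, eLpNorm (F l) 1 m ≠ ∞ := by
    have h1 : ∀ l, eLpNorm (F l) 1 m = ENNReal.ofReal (∫ x, ‖F l x‖ ∂m) := fun l => by
      rw [eLpNorm_one_eq_lintegral_enorm, ofReal_integral_norm_eq_lintegral_enorm (hF1 l)]
    simp only [h1]
    exact hF3.tsum_ofReal_ne_top
  have hF5 : ∀ l, MemLp (F l) 1 m := fun l => memLp_one_iff_integrable.2 (hF1 l)
  have hF6 := hasSum_integral_of_summable_integral_norm hF1 hF3
  simp only [hF2] at hF6
  have hF7 : Integrable (fun x => ∑' l, F l x) m :=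
    memLp_one_iff_integrable.1 (memLp_tsum_of_tsum_eLpNorm_ne_top hF5 hF4).1
  have hF8 : Measurable fun x => ∑' l, F l x := measurable_real_tsum hFm
  refine ⟨?_, ?_, ?_⟩
  · have h1 : ∀ᵐ x ∂m, (∀ l, Integrable (h l) (trajSA P π x)) ∧ Summable fun l => F l x := by
      filter_upwards [ae_all_iff.2 fun l => Measure.ae_integrable_of_integrable_comp (hi l),
        ae_summable_of_tsum_eLpNorm_ne_top hF5 hF4] with x h1 h2 using ⟨h1, h2⟩
    rw [← map_pair_zero (P := P) (π := π) (m := m)] at h1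
    exact ae_of_ae_map hx.aemeasurable h1
  · rw [← map_pair_zero (P := P) (π := π) (m := m)] at hF7
    exact (integrable_map_measure hF8.aestronglyMeasurable hx.aemeasurable).1 hF7
  · have h1 := integral_map hx.aemeasurable
      (hF8.aestronglyMeasurable (μ := (trajSA P π ∘ₘ m).map fun ω => (st ω 0, act ω 0)))
    rw [map_pair_zero] at h1
    exact h1.symm.trans (hT.unique hF6).symm

/-- The unified and the generalized estimators at time `0`, for an arbitrary law of the initial
state and action: integrability and difference of the second moments. -/
theorem second_moment_uae_sub_gae
    (hγ₀ : 0 ≤ γ) (hγ₁ : γ < 1) {lam : ℝ} (hlam₀ : 0 ≤ lam) (hlam₁ : lam ≤ 1)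
    (hQ : ∀ s a, ∫⁻ ω, absRet γ ω ∂(trajSA P π (s, a)) < ∞)
    (hV : ∀ s, ∫⁻ ω, absRet γ ω ∂(trajS P π s) < ∞) {C : ℝ≥0}
    (hr : ∀ k, eLpNorm (fun ω => rew ω k) 2 (trajSA P π ∘ₘ m) ≤ C)
    {b : S → ℝ} (hb : Measurable b) (hb2 : MemLp (fun ω => b (st ω 0)) 2 (trajSA P π ∘ₘ m))
    (hV2 : MemLp (fun ω => Vval P π γ (st ω 0)) 2 (trajSA P π ∘ₘ m))
    {Ψ : S → A → ℝ} {ε : ℝ} (hε : ε * ε = ε)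
    (hΨ : ∀ s a, Ψ s a = Vval P π γ s + ε * adv P π γ (s, a)) :
    let gap : S → A → ℕ → ℝ := fun s a l =>
      ∫ ω, (Ψ (st ω (l + 1)) (act ω (l + 1)) - Vval P π γ (st ω (l + 1))) ^ 2 ∂(trajSA P π (s, a))
    let irred : Traj S A → ℝ := fun ω =>
      ∑' l : ℕ, (γ * lam) ^ (2 * l) * (γ ^ 2 * (1 - lam ^ 2)) * gap (st ω 0) (act ω 0) l
    let red : Traj S A → ℝ := fun ω => b (st ω 0) ^ 2 - Vval P π γ (st ω 0) ^ 2
      - 2 * Qval P π γ (st ω 0) (act ω 0) * (b (st ω 0) - Vval P π γ (st ω 0))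
    (∀ᵐ ω ∂(trajSA P π ∘ₘ m), (Summable fun l => uaeTerm γ lam Ψ b 0 ω (l + 1)) ∧
      (Summable fun l => gaeTerm γ lam (Vval P π γ) 0 ω l) ∧
      (∀ l : ℕ, Integrable (fun ω' : Traj S A =>
          (Ψ (st ω' (l + 1)) (act ω' (l + 1)) - Vval P π γ (st ω' (l + 1))) ^ 2)
        (trajSA P π (st ω 0, act ω 0))) ∧
      (Summable fun l : ℕ =>
        (γ * lam) ^ (2 * l) * (γ ^ 2 * (1 - lam ^ 2)) * gap (st ω 0) (act ω 0) l)) ∧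
    MemLp (fun ω => uae γ lam Ψ b 0 ω) 2 (trajSA P π ∘ₘ m) ∧
    MemLp (fun ω => gae γ lam (Vval P π γ) 0 ω) 2 (trajSA P π ∘ₘ m) ∧
    Integrable irred (trajSA P π ∘ₘ m) ∧ Integrable red (trajSA P π ∘ₘ m) ∧
    ∫ ω, uae γ lam Ψ b 0 ω ^ 2 ∂(trajSA P π ∘ₘ m)
        - ∫ ω, gae γ lam (Vval P π γ) 0 ω ^ 2 ∂(trajSA P π ∘ₘ m)
      = ∫ ω, irred ω ∂(trajSA P π ∘ₘ m) + ∫ ω, red ω ∂(trajSA P π ∘ₘ m) ∧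
    (∀ᵐ ω ∂(trajSA P π ∘ₘ m),
      (Summable fun l => (γ * lam) ^ l • adv P π γ (st ω (l + 1), act ω (l + 1))) ∧
      uae γ lam Ψ b 0 ω = gae γ lam (Vval P π γ) 0 ω + (Vval P π γ (st ω 0) - b (st ω 0))
        + γ * (1 - lam) * ε * ∑' l, (γ * lam) ^ l • adv P π γ (st ω (l + 1), act ω (l + 1))) ∧
    ∑' l, eLpNorm (fun ω => (γ * lam) ^ l • adv P π γ (st ω (l + 1), act ω (l + 1))) 2
      (trajSA P π ∘ₘ m) ≠ ∞ := by
  intro gap irred red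
  set μ := trajSA P π ∘ₘ m with hμ
  set κ := γ * lam with hκ
  have hκ₀ : 0 ≤ κ := mul_nonneg hγ₀ hlam₀
  have hκ₁ : κ < 1 := (mul_le_of_le_one_right hγ₀ hlam₁).trans_lt hγ₁
  obtain ⟨B, hB1, hB2⟩ := exists_eLpNorm_td_adv_le hγ₀ hγ₁ hV hr hV2
  have hVm := measurable_Vval P π γ
  have hadvm : ∀ n, Measurable fun ω : Traj S A => adv P π γ (st ω n, act ω n) := fun n => by
    fun_prop
  have htd : ∀ n, MemLp (fun ω => td γ (Vval P π γ) ω n) 2 μ := fun n =>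
    ⟨(measurable_td hVm n).aestronglyMeasurable, lt_of_le_of_lt (hB1 n) ENNReal.coe_lt_top⟩
  have hadv : ∀ n, MemLp (fun ω => adv P π γ (st ω n, act ω n)) 2 μ := fun n =>
    ⟨(hadvm n).aestronglyMeasurable, lt_of_le_of_lt (hB2 n) ENNReal.coe_lt_top⟩
  have htop : ENNReal.ofReal (1 - κ)⁻¹ * B ≠ ∞ :=
    ENNReal.mul_ne_top ENNReal.ofReal_ne_top ENNReal.coe_ne_top
  have hs1 := ne_top_of_le_ne_top htop (tsum_eLpNorm_geometric_le hκ₀ hκ₁ hB1)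
  have hs2 := ne_top_of_le_ne_top htop
    (tsum_eLpNorm_geometric_le hκ₀ hκ₁ fun n => hB2 (n + 1))
  have hf1 : ∀ n, MemLp (fun ω => κ ^ n • td γ (Vval P π γ) ω n) 2 μ :=
    fun n => (htd n).const_mul _
  have hf2 : ∀ n, MemLp (fun ω => κ ^ n • adv P π γ (st ω (n + 1), act ω (n + 1))) 2 μ :=
    fun n => (hadv (n + 1)).const_mul _
  set M : Traj S A → ℝ := fun ω => ∑' l, κ ^ l * adv P π γ (st ω (l + 1), act ω (l + 1)) with hM
  set c : S → ℝ := fun s => Vval P π γ s - b s with hc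
  set G : Traj S A → ℝ := fun ω => gae γ lam (Vval P π γ) 0 ω with hG
  set U : Traj S A → ℝ := fun ω => uae γ lam Ψ b 0 ω with hU
  have hGA : ∀ ω, G ω = ∑' l, κ ^ l * td γ (Vval P π γ) ω l := fun ω => by
    simp only [hG, gae, gaeTerm_eq, zero_add, hκ]
  have hcm : Measurable c := hVm.sub hb
  have hc2 : MemLp (fun ω => c (st ω 0)) 2 μ := hV2.sub hb2
  have hM2 : MemLp M 2 μ := (memLp_tsum_of_tsum_eLpNorm_ne_top hf2 hs2).1
  have hG2 : MemLp G 2 μ := by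
    have := (memLp_tsum_of_tsum_eLpNorm_ne_top hf1 hs1).1
    simpa only [smul_eq_mul, ← hGA] using this
  have hae : ∀ᵐ ω ∂μ, (Summable fun l => uaeTerm γ lam Ψ b 0 ω (l + 1)) ∧
      (Summable fun l => gaeTerm γ lam (Vval P π γ) 0 ω l) ∧
      (Summable fun l => κ ^ l • adv P π γ (st ω (l + 1), act ω (l + 1))) ∧
      U ω = G ω + c (st ω 0) + γ * (1 - lam) * ε * M ω := by
    filter_upwards [ae_summable_of_tsum_eLpNorm_ne_top hf1 hs1,
      ae_summable_of_tsum_eLpNorm_ne_top hf2 hs2] with ω h1 h2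
    have h1' : Summable fun l => gaeTerm γ lam (Vval P π γ) 0 ω l :=
      h1.congr fun l => by rw [gaeTerm_eq, zero_add, smul_eq_mul]
    have h2' : Summable fun l => (γ * lam) ^ l * (ε * adv P π γ (st ω (l + 1), act ω (l + 1))) := by
      refine (h2.mul_left ε).congr fun l => ?_
      rw [smul_eq_mul, mul_left_comm]
    obtain ⟨h3, h4⟩ := uae_eq_gae_add (b := b) (D := fun s a => ε * adv P π γ (s, a)) hΨ h1' h2'
    refine ⟨h3, h1', h2, ?_⟩
    simp only [hU, h4, hM, hG, hc, mul_left_comm _ ε, tsum_mul_left]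
    ring
  have hUeq : U =ᵐ[μ] fun ω => G ω + c (st ω 0) + γ * (1 - lam) * ε * M ω := 
    hae.mono fun ω h => h.2.2.2
  have hU2 : MemLp U 2 μ :=
    (memLp_congr_ae hUeq).2 ((hG2.add hc2).add (hM2.const_mul _))
  obtain ⟨hAM, hMM⟩ := hasSum_second_moments hQ hV htd hadv hs1 hs2
  obtain ⟨hcA, hcM⟩ := integral_baseline_mul hQ hV htd hadv hs1 hs2 hcm hc2
  simp only [← hGA] at hAM hcA
  have hgap : ∀ s a, Ψ s a - Vval P π γ s = ε * adv P π γ (s, a) := fun s a => by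
    rw [hΨ]; ring
  have hsq : ∀ l, Integrable (fun ω => (ε * adv P π γ (st ω (l + 1), act ω (l + 1))) ^ 2) μ :=
    fun l => ((hadv (l + 1)).const_mul ε).integrable_sq
  -- The coefficient is 2γ(1-λ)·γλ + γ²(1-λ)² = γ²(1-λ²); ε² = ε lets the term linear in ε and the
  -- quadratic one combine.
  have hT : HasSum (fun l => κ ^ (2 * l) * (γ ^ 2 * (1 - lam ^ 2)) *
      ∫ ω, (ε * adv P π γ (st ω (l + 1), act ω (l + 1))) ^ 2 ∂μ)
      (2 * (γ * (1 - lam) * ε) * (∫ ω, G ω * M ω ∂μ)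
        + (γ * (1 - lam) * ε) ^ 2 * ∫ ω, M ω * M ω ∂μ) := by
    refine hasSum_of_forall_eq (fun l => ?_)
      ((hAM.mul_left (2 * (γ * (1 - lam) * ε))).add (hMM.mul_left ((γ * (1 - lam) * ε) ^ 2)))
    simp only [mul_pow, integral_const_mul, sq ε, hε, hκ]
    ring
  have hcoef : ∀ l, 0 ≤ κ ^ (2 * l) * (γ ^ 2 * (1 - lam ^ 2)) := fun l => by
    have : 0 ≤ 1 - lam ^ 2 := by nlinarith
    positivity
  obtain ⟨hI1, hI2, hI3⟩ := integral_tsum_conditional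
    (h := fun l ω => (ε * adv P π γ (st ω (l + 1), act ω (l + 1))) ^ 2)
    (fun l => ((hadvm (l + 1)).const_mul ε).pow_const 2) (fun l ω => sq_nonneg _) hsq hcoef hT
  -- With c = V - b, c² + 2c(Q - V) = b² - V² - 2Q(b - V).
  have hred : ∀ ω, red ω = c (st ω 0) * c (st ω 0)
      + 2 * (c (st ω 0) * adv P π γ (st ω 0, act ω 0)) := fun ω => by
    simp only [red, hc, adv]; ring
  have hcc : Integrable (fun ω => c (st ω 0) * c (st ω 0)) μ := hc2.integrable_mul hc2
  have hcd : Integrable (fun ω => c (st ω 0) * adv P π γ (st ω 0, act ω 0)) μ :=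
    hc2.integrable_mul (hadv 0)
  refine ⟨?_, hU2, hG2, ?_, ?_, ?_, hae.mono fun ω h => h.2.2, hs2⟩
  · filter_upwards [hae, hI1] with ω h1 h2
    simp only [gap, hgap]
    exact ⟨h1.1, h1.2.1, h2.1, h2.2⟩
  · simp only [irred, gap, hgap]
    exact hI2
  · exact (hcc.add (hcd.const_mul 2)).congr (ae_of_all _ fun ω => (hred ω).symm)
  · have hr1 : ∫ ω, red ω ∂μ = ∫ ω, c (st ω 0) * c (st ω 0) ∂μ
        + 2 * ∫ ω, c (st ω 0) * G ω ∂μ := by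
      simp only [hred]
      rw [integral_add hcc (hcd.const_mul 2), integral_const_mul, hcA]
    have hi1 : ∫ ω, irred ω ∂μ = 2 * (γ * (1 - lam) * ε) * (∫ ω, G ω * M ω ∂μ)
        + (γ * (1 - lam) * ε) ^ 2 * ∫ ω, M ω * M ω ∂μ := by
      simp only [irred, gap, hgap]
      exact hI3
    have hu1 : ∫ ω, U ω ^ 2 ∂μ = ∫ ω, (G ω ^ 2 + (c (st ω 0) * c (st ω 0)
        + (2 * (c (st ω 0) * G ω) + (2 * (γ * (1 - lam) * ε) * (G ω * M ω)
        + (2 * (γ * (1 - lam) * ε) * (c (st ω 0) * M ω)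
        + (γ * (1 - lam) * ε) ^ 2 * (M ω * M ω)))))) ∂μ := by
      refine integral_congr_ae ?_
      filter_upwards [hUeq] with ω h
      rw [h]; ring
    have i1 : Integrable (fun ω => G ω ^ 2) μ := hG2.integrable_sq
    have i2 : Integrable (fun ω => 2 * (c (st ω 0) * G ω)) μ :=
      (hc2.integrable_mul hG2).const_mul 2
    have i3 : Integrable (fun ω => 2 * (γ * (1 - lam) * ε) * (G ω * M ω)) μ :=
      (hG2.integrable_mul hM2).const_mul _
    have i4 : Integrable (fun ω => 2 * (γ * (1 - lam) * ε) * (c (st ω 0) * M ω)) μ :=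
      (hc2.integrable_mul hM2).const_mul _
    have i5 : Integrable (fun ω => (γ * (1 - lam) * ε) ^ 2 * (M ω * M ω)) μ :=
      (hM2.integrable_mul hM2).const_mul _
    have j4 := i4.add i5
    have j3 := i3.add j4
    have j2 := i2.add j3
    have j1 := hcc.add j2
    simp only [Pi.add_def] at j1 j2 j3 j4
    change ∫ ω, U ω ^ 2 ∂μ - ∫ ω, G ω ^ 2 ∂μ = _
    rw [hr1, hi1, hu1, integral_add i1 j1, integral_add hcc j2, integral_add i2 j3,
      integral_add i3 j4, integral_add i4 i5]
    simp only [integral_const_mul]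
    rw [hcM]
    ring

end UAE

end

/-! ### Reweighting by the squared score, and the mean of the score -/

noncomputable section

namespace UAE

section Weight

variable {Ω E : Type*} [MeasurableSpace Ω] [NormedAddCommGroup E] [NormedSpace ℝ E]
  [MeasurableSpace E] [BorelSpace E] [SecondCountableTopology E]
  {μ : Measure Ω} {u : Ω → E}

/-- Trades the vector X·u under μ for the scalar X under the reweighted law; almost sure statements
there are those on {u ≠ 0} under μ. -/
lemma eLpNorm_smul_eq_withDensity (hu : Measurable u) {X : Ω → ℝ} (hX : Measurable X) :
    eLpNorm (fun ω => X ω • u ω) 2 μ = eLpNorm X 2 (μ.withDensity fun ω => ‖u ω‖ₑ ^ 2) := by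
  refine (ENNReal.pow_right_strictMono two_ne_zero).injective ?_
  simp only [eLpNorm_two_sq_eq_lintegral]
  rw [lintegral_withDensity_eq_lintegral_mul _ (by fun_prop) (by fun_prop)]
  refine lintegral_congr fun ω => ?_
  rw [enorm_smul, mul_pow, Pi.mul_apply, mul_comm]

lemma memLp_withDensity_iff (hu : Measurable u) {X : Ω → ℝ} (hX : Measurable X) :
    MemLp X 2 (μ.withDensity fun ω => ‖u ω‖ₑ ^ 2) ↔ MemLp (fun ω => X ω • u ω) 2 μ := by
  rw [MemLp, MemLp, eLpNorm_smul_eq_withDensity hu hX]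
  exact and_congr_left fun _ => ⟨fun _ => (hX.smul hu).aestronglyMeasurable,
    fun _ => hX.aestronglyMeasurable⟩

lemma integral_withDensity_enorm_sq (hu : Measurable u) (X : Ω → ℝ) :
    ∫ ω, X ω ∂(μ.withDensity fun ω => ‖u ω‖ₑ ^ 2) = ∫ ω, ‖u ω‖ ^ 2 * X ω ∂μ := by
  rw [integral_withDensity_eq_integral_toReal_smul (by fun_prop)
    (Filter.Eventually.of_forall fun ω => by finiteness)]
  simp

lemma integrable_withDensity_enorm_sq_iff (hu : Measurable u) (X : Ω → ℝ) :
    Integrable X (μ.withDensity fun ω => ‖u ω‖ₑ ^ 2) ↔ Integrable (fun ω => ‖u ω‖ ^ 2 * X ω) μ := by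
  rw [integrable_withDensity_iff_integrable_smul' (by fun_prop)
    (Filter.Eventually.of_forall fun ω => by finiteness)]
  simp

lemma ae_withDensity_enorm_sq_iff (hu : Measurable u) {p : Ω → Prop} :
    (∀ᵐ ω ∂(μ.withDensity fun ω => ‖u ω‖ₑ ^ 2), p ω) ↔ ∀ᵐ ω ∂μ, u ω ≠ 0 → p ω := by
  rw [ae_withDensity_iff (by fun_prop)]
  simp

end Weight

variable {S A : Type*} [MeasurableSpace S] [MeasurableSpace A]

section Chain

variable {P : Kernel (S × A) (ℝ × S)} [IsMarkovKernel P] {π : Kernel S A} [IsMarkovKernel π]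

/-- Reweighting a trajectory law by a function of the initial state and action amounts to
reweighting the law of the latter. -/
lemma comp_trajSA_withDensity (m : Measure (S × A)) {f : S × A → ℝ≥0∞} (hf : Measurable f) :
    (trajSA P π ∘ₘ m).withDensity (fun ω => f (st ω 0, act ω 0))
      = trajSA P π ∘ₘ (m.withDensity f) := by
  refine Measure.ext_of_lintegral _ fun g hg => ?_
  have hf' : Measurable fun ω : Traj S A => f (st ω 0, act ω 0) := by fun_prop
  rw [lintegral_withDensity_eq_lintegral_mul _ hf' hg,
    Measure.lintegral_bind (Kernel.aemeasurable _) (hf'.mul hg).aemeasurable,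
    Measure.lintegral_bind (Kernel.aemeasurable _) hg.aemeasurable,
    lintegral_withDensity_eq_lintegral_mul _ hf hg.lintegral_kernel]
  refine lintegral_congr fun x => ?_
  -- Under `trajSA` the initial pair is deterministic, so the weight is a constant that leaves the
  -- inner integral.
  have h0 : ∀ᵐ ω ∂(trajSA P π x), f (st ω 0, act ω 0) = f x := by
    have h : ∀ᵐ y ∂((trajSA P π x).map (fun ω => ω 0)), f (pair y) = f x := by
      rw [trajSA_map_zero, ae_dirac_iff (measurableSet_eq_fun (by fun_prop) (by fun_prop))]
      rfl
    exact ae_of_ae_map (measurable_record 0).aemeasurable h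
  rw [Pi.mul_apply, ← lintegral_const_mul _ hg]
  refine lintegral_congr_ae ?_
  filter_upwards [h0] with ω h
  rw [Pi.mul_apply, h]

lemma trajLaw_eq (ρ : Measure S) [SFinite ρ] : trajLaw P π ρ = trajSA P π ∘ₘ (ρ ⊗ₘ π) := by
  rw [trajLaw, trajS, Measure.compProd_eq_comp_prod, Measure.comp_assoc]

/-- The trajectory from time `t` on is a trajectory started from the law of `s_t`. -/
lemma exists_trajLaw_map_restart (ρ : Measure S) [IsProbabilityMeasure ρ] (t : ℕ) :
    ∃ ρ' : Measure S, IsProbabilityMeasure ρ' ∧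
      (trajLaw P π ρ).map (restart t) = trajLaw P π ρ' := by
  have h : ∃ ρ' : Measure S, IsProbabilityMeasure ρ' ∧ pairLaw P π (ρ ⊗ₘ π) t = ρ' ⊗ₘ π := by
    cases t with
    | zero => exact ⟨ρ, inferInstance, rfl⟩
    | succ t =>
      refine ⟨P.snd ∘ₘ pairLaw P π (ρ ⊗ₘ π) t, inferInstance, ?_⟩
      rw [pairLaw, pairKernel_comp]
  obtain ⟨ρ', h1, h2⟩ := h
  refine ⟨ρ', h1, ?_⟩
  rw [trajLaw_eq, trajLaw_eq, comp_trajSA_map_restart, h2]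

end Chain

namespace PolicyFamily

variable {d : ℕ} {ν : Measure A}

/-- The log-derivative identity ∇π = π·∇log π. It persists where the density vanishes: there θ
minimizes a nonnegative function, so both sides are 0, whatever the score is. -/
lemma hasGradientAt_dens {F : PolicyFamily d S ν} {θ : EuclideanSpace ℝ (Fin d)} {s : S} {a : A}
    (h : DifferentiableAt ℝ (fun θ' => F.dens θ' s a) θ) :
    HasGradientAt (fun θ' => F.dens θ' s a) (F.dens θ s a • F.score θ s a) θ := by
  by_cases h0 : F.dens θ s a = 0
  · have hmin : IsLocalMin (fun θ' => F.dens θ' s a) θ :=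
      Filter.Eventually.of_forall fun θ' => by
        simp only [h0]; exact F.dens_nonneg θ' s a
    have h1 := h.hasFDerivAt
    rw [hmin.fderiv_eq_zero] at h1
    rw [h0, zero_smul, hasGradientAt_iff_hasFDerivAt, map_zero]
    exact h1
  · have h1 := h.hasGradientAt
    have h2 := (hasGradientAt_iff_hasFDerivAt.1 h1).log h0
    have h3 : HasGradientAt (fun θ' => Real.log (F.dens θ' s a))
        ((F.dens θ s a)⁻¹ • gradient (fun θ' => F.dens θ' s a) θ) θ := by
      rw [hasGradientAt_iff_hasFDerivAt]
      simpa using h2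
    have h4 : F.dens θ s a • F.score θ s a = gradient (fun θ' => F.dens θ' s a) θ := by
      rw [score, h3.gradient, smul_inv_smul₀ h0]
    rw [h4]
    exact h1

lemma measurable_dens_right (F : PolicyFamily d S ν) (θ : EuclideanSpace ℝ (Fin d)) (s : S) :
    Measurable (F.dens θ s) :=
  (F.measurable_dens θ).comp measurable_prodMk_left

lemma integrable_dens (F : PolicyFamily d S ν) (θ : EuclideanSpace ℝ (Fin d)) (s : S) :
    Integrable (F.dens θ s) ν := by
  refine ⟨(F.measurable_dens_right θ s).aestronglyMeasurable, ?_⟩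
  rw [hasFiniteIntegral_iff_ofReal (Filter.Eventually.of_forall (F.dens_nonneg θ s)),
    F.lintegral_dens]
  exact ENNReal.one_lt_top

lemma integral_dens (F : PolicyFamily d S ν) (θ : EuclideanSpace ℝ (Fin d)) (s : S) :
    ∫ a, F.dens θ s a ∂ν = 1 := by
  rw [integral_eq_lintegral_of_nonneg_ae (Filter.Eventually.of_forall (F.dens_nonneg θ s))
    (F.measurable_dens_right θ s).aestronglyMeasurable, F.lintegral_dens, ENNReal.toReal_one]

/-- The score has mean zero in every state. -/
lemma integral_score [SFinite ν] {F : PolicyFamily d S ν} {θ : EuclideanSpace ℝ (Fin d)}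
    (hF : F.RegularAt θ) (hu : Measurable (Function.uncurry (F.score θ))) (s : S) :
    ∫ a, F.score θ s a ∂(F.kernel θ s) = 0 := by
  obtain ⟨g, hg, δ, hδ, h⟩ := hF s
  have hd := F.measurable_dens_right θ s
  have hsc : Measurable (F.score θ s) := hu.comp measurable_prodMk_left
  let X : A → EuclideanSpace ℝ (Fin d) := fun a => F.dens θ s a • F.score θ s a
  have hX : AEStronglyMeasurable X ν := (hd.smul hsc).aestronglyMeasurable
  have key := hasFDerivAt_integral_of_dominated_loc_of_lip' (μ := ν) (𝕜 := ℝ)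
    (F := fun θ' a => F.dens θ' s a) (x₀ := θ) (bound := g)
    (F' := fun a => InnerProductSpace.toDual ℝ _ (X a))
    (Metric.ball_mem_nhds θ hδ)
    (fun θ' _ => (F.measurable_dens_right θ' s).aestronglyMeasurable) (F.integrable_dens θ s)
    ((InnerProductSpace.toDual ℝ _).continuous.comp_aestronglyMeasurable hX)
    (h.mono fun a ha => ha.2) hg
    (h.mono fun a ha => hasGradientAt_iff_hasFDerivAt.1 (hasGradientAt_dens ha.1))
  obtain ⟨hi, hder⟩ := key
  simp only [F.integral_dens] at hder
  have h0 := hder.unique (hasFDerivAt_const (1 : ℝ) θ)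
  have hXi : Integrable X ν := by
    refine hi.norm.mono hX (Filter.Eventually.of_forall fun a => ?_)
    simp
  -- Differentiating ∫ π_θ dν = 1 under the integral sign; vectors are tested against each direction
  -- c.
  have hX0 : ∫ a, X a ∂ν = 0 := by
    refine ext_inner_left ℝ fun c => ?_
    rw [inner_zero_right, ← integral_inner hXi]
    have h1 : ∀ a, inner ℝ c (X a) = InnerProductSpace.toDual ℝ _ (X a) c := fun a => by
      rw [InnerProductSpace.toDual_apply_apply, real_inner_comm]
    simp only [h1]
    rw [← ContinuousLinearMap.integral_apply hi, h0]
    rfl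
  rw [kernel_apply, integral_withDensity_eq_integral_toReal_smul hd.ennreal_ofReal
    (Filter.Eventually.of_forall fun a => ENNReal.ofReal_lt_top)]
  simpa only [ENNReal.toReal_ofReal (F.dens_nonneg θ s _)] using hX0

end PolicyFamily

end UAE

end

/-! ### Equality of means and the variance formula at time 0 -/

noncomputable section

namespace UAE

variable {S A : Type*} [MeasurableSpace S] [MeasurableSpace A]

section Mean

variable {P : Kernel (S × A) (ℝ × S)} [IsMarkovKernel P] {π : Kernel S A} [IsMarkovKernel π]
  {γ : ℝ} {E : Type*} [NormedAddCommGroup E] [NormedSpace ℝ E] [CompleteSpace E]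
  [MeasurableSpace E] [BorelSpace E] [SecondCountableTopology E]

/-- Discounted sums of later advantages are uncorrelated with functions of the initial state and
action. -/
lemma integral_tsum_adv_smul {m : Measure (S × A)} [IsProbabilityMeasure m]
    (hV : ∀ s, ∫⁻ ω, absRet γ ω ∂(trajS P π s) < ∞) {κ : ℝ} {v : S × A → E} (hv : Measurable v)
    (hs : ∑' l, eLpNorm (fun ω => κ ^ l • adv P π γ (st ω (l + 1), act ω (l + 1))) 2
      ((trajSA P π ∘ₘ m).withDensity fun ω => ‖v (st ω 0, act ω 0)‖ₑ ^ 2) ≠ ∞)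
    (hsum : ∀ᵐ ω ∂(trajSA P π ∘ₘ m), v (st ω 0, act ω 0) ≠ 0 →
      Summable fun l => κ ^ l • adv P π γ (st ω (l + 1), act ω (l + 1))) :
    Integrable (fun ω => (∑' l, κ ^ l • adv P π γ (st ω (l + 1), act ω (l + 1)))
      • v (st ω 0, act ω 0)) (trajSA P π ∘ₘ m) ∧
    ∫ ω, (∑' l, κ ^ l • adv P π γ (st ω (l + 1), act ω (l + 1)))
      • v (st ω 0, act ω 0) ∂(trajSA P π ∘ₘ m) = 0 := by
  set μ := trajSA P π ∘ₘ m
  have hu : Measurable fun ω : Traj S A => v (st ω 0, act ω 0) := by fun_prop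
  have hd : ∀ l, Measurable fun ω : Traj S A =>
      κ ^ l • adv P π γ (st ω (l + 1), act ω (l + 1)) := fun l => by fun_prop
  have hs' : ∑' l, eLpNorm (fun ω => (κ ^ l • adv P π γ (st ω (l + 1), act ω (l + 1)))
      • v (st ω 0, act ω 0)) 2 μ ≠ ∞ := by
    simpa only [eLpNorm_smul_eq_withDensity hu (hd _)] using hs
  have hf : ∀ l, MemLp (fun ω => (κ ^ l • adv P π γ (st ω (l + 1), act ω (l + 1)))
      • v (st ω 0, act ω 0)) 2 μ := fun l =>
    ⟨((hd l).smul hu).aestronglyMeasurable, (ENNReal.ne_top_of_tsum_ne_top hs' l).lt_top⟩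
  have heq : (fun ω => ∑' l, (κ ^ l • adv P π γ (st ω (l + 1), act ω (l + 1)))
      • v (st ω 0, act ω 0)) =ᵐ[μ] fun ω =>
      (∑' l, κ ^ l • adv P π γ (st ω (l + 1), act ω (l + 1))) • v (st ω 0, act ω 0) := by
    filter_upwards [hsum] with ω h
    by_cases h0 : v (st ω 0, act ω 0) = 0
    · simp [h0]
    · exact (h h0).tsum_smul_const _
  have hz : ∀ l, ∫ ω, (κ ^ l • adv P π γ (st ω (l + 1), act ω (l + 1)))
      • v (st ω 0, act ω 0) ∂μ = 0 := fun l => by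
    have hG : Measurable[preActAlg S A l] fun ω : Traj S A => κ ^ l • v (st ω 0, act ω 0) :=
      (hv.const_smul (κ ^ l)).comp (measurable_pair_preActAlg (Nat.zero_le l))
    have h1 : ∀ ω : Traj S A, (κ ^ l • adv P π γ (st ω (l + 1), act ω (l + 1)))
        • v (st ω 0, act ω 0)
        = adv P π γ (st ω (l + 1), act ω (l + 1)) • κ ^ l • v (st ω 0, act ω 0) := fun ω => by
      rw [smul_eq_mul, mul_comm, mul_smul]
    have h2 := (hf l).integrable (by norm_num)
    simp only [h1] at h2 ⊢
    exact integral_adv_smul hV hG.stronglyMeasurable h2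
  -- The original law is a probability, so the constant 1 is an admissible L² multiplier.
  have h3 := hasSum_integral_smul_of_tsum_eLpNorm_ne_top hf hs' (memLp_const (1 : ℝ))
  simp only [one_smul, hz] at h3
  refine ⟨((memLp_tsum_of_tsum_eLpNorm_ne_top hf hs').1.integrable (by norm_num)).congr heq, ?_⟩
  rw [← integral_congr_ae heq]
  exact h3.unique hasSum_zero

end Mean

/-- The comparison of the two estimators at time `0`. -/
theorem variance_uae_sub_gae_zero
    (P : Kernel (S × A) (ℝ × S)) [IsMarkovKernel P] (ρ : Measure S) [IsProbabilityMeasure ρ]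
    (γ : ℝ) (hγ₀ : 0 ≤ γ) (hγ₁ : γ < 1) (lam : ℝ) (hlam₀ : 0 ≤ lam) (hlam₁ : lam ≤ 1)
    {d : ℕ} (ν : Measure A) [SigmaFinite ν] (F : PolicyFamily d S ν)
    (θ : EuclideanSpace ℝ (Fin d)) (hF : F.RegularAt θ)
    (hu : Measurable (Function.uncurry (F.score θ)))
    (b : S → ℝ) (hb : Measurable b)
    (hQ : ∀ s a, ∫⁻ ω, absRet γ ω ∂(trajSA P (F.kernel θ) (s, a)) < ∞)
    (hV : ∀ s, ∫⁻ ω, absRet γ ω ∂(trajS P (F.kernel θ) s) < ∞)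
    (Ψ : S → A → ℝ)
    (hΨ : Ψ = Qval P (F.kernel θ) γ ∨ Ψ = fun s _ => Vval P (F.kernel θ) γ s)
    (hr2 : ∃ C : ℝ≥0, ∀ k, eLpNorm
      (fun ω => rew ω k • F.score θ (st ω 0) (act ω 0)) 2 (trajLaw P (F.kernel θ) ρ) ≤ C)
    (hb2 : MemLp (fun ω => b (st ω 0) • F.score θ (st ω 0) (act ω 0)) 2
      (trajLaw P (F.kernel θ) ρ))
    (hV2 : MemLp (fun ω => Vval P (F.kernel θ) γ (st ω 0) • F.score θ (st ω 0) (act ω 0)) 2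
      (trajLaw P (F.kernel θ) ρ)) :
    let μ : Measure (Traj S A) := trajLaw P (F.kernel θ) ρ
    let Q : S → A → ℝ := Qval P (F.kernel θ) γ
    let V : S → ℝ := Vval P (F.kernel θ) γ
    let u : Traj S A → EuclideanSpace ℝ (Fin d) := fun ω => F.score θ (st ω 0) (act ω 0)
    let gap : S → A → ℕ → ℝ := fun s a l =>
      ∫ ω, (Ψ (st ω (l + 1)) (act ω (l + 1)) - V (st ω (l + 1))) ^ 2
        ∂(trajSA P (F.kernel θ) (s, a))
    let irred : Traj S A → ℝ := fun ω => ‖u ω‖ ^ 2 *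
      ∑' l : ℕ, (γ * lam) ^ (2 * l) * (γ ^ 2 * (1 - lam ^ 2)) * gap (st ω 0) (act ω 0) l
    let red : Traj S A → ℝ := fun ω => ‖u ω‖ ^ 2 *
      (b (st ω 0) ^ 2 - V (st ω 0) ^ 2
        - 2 * Q (st ω 0) (act ω 0) * (b (st ω 0) - V (st ω 0)))
    (∀ᵐ ω ∂μ, u ω ≠ 0 →
      (Summable fun l => uaeTerm γ lam Ψ b 0 ω (l + 1)) ∧
      (Summable fun l => gaeTerm γ lam V 0 ω l) ∧
      (∀ l : ℕ, Integrable
        (fun ω' : Traj S A =>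
          (Ψ (st ω' (l + 1)) (act ω' (l + 1)) - V (st ω' (l + 1))) ^ 2)
        (trajSA P (F.kernel θ) (st ω 0, act ω 0))) ∧
      (Summable fun l : ℕ =>
        (γ * lam) ^ (2 * l) * (γ ^ 2 * (1 - lam ^ 2)) * gap (st ω 0) (act ω 0) l)) ∧
    MemLp (fun ω => uae γ lam Ψ b 0 ω • u ω) 2 μ ∧
    MemLp (fun ω => gae γ lam V 0 ω • u ω) 2 μ ∧
    Integrable irred μ ∧ Integrable red μ ∧
    vecVar (fun ω => uae γ lam Ψ b 0 ω • u ω) μ - vecVar (fun ω => gae γ lam V 0 ω • u ω) μ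
      = (∫ ω, irred ω ∂μ) + ∫ ω, red ω ∂μ := by
  intro μ Q V u gap irred red
  -- ε = 1 for Ψ = Q and ε = 0 for Ψ = V.
  obtain ⟨ε, hε, hΨε⟩ : ∃ ε : ℝ, ε * ε = ε ∧
      ∀ s a, Ψ s a = Vval P (F.kernel θ) γ s + ε * adv P (F.kernel θ) γ (s, a) := by
    rcases hΨ with rfl | rfl
    · exact ⟨1, by norm_num, fun s a => by simp [adv]⟩
    · exact ⟨0, by norm_num, fun s a => by simp⟩
  have hVm : Measurable V := measurable_Vval P (F.kernel θ) γ
  have hΨm : Measurable (Function.uncurry Ψ) := by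
    have : Function.uncurry Ψ = fun x : S × A => Vval P (F.kernel θ) γ x.1
        + ε * adv P (F.kernel θ) γ x := funext fun x => hΨε x.1 x.2
    rw [this]; fun_prop
  set m : Measure (S × A) := ρ ⊗ₘ F.kernel θ with hm
  set v : S × A → EuclideanSpace ℝ (Fin d) := Function.uncurry (F.score θ)
  have hum : Measurable u := hu.comp ((measurable_st 0).prodMk (measurable_act 0))
  have hμ : μ = trajSA P (F.kernel θ) ∘ₘ m := trajLaw_eq ρ
  have hμp : IsProbabilityMeasure μ := by simp only [μ]; infer_instance
  have hμ' : μ.withDensity (fun ω => ‖u ω‖ₑ ^ 2)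
      = trajSA P (F.kernel θ) ∘ₘ (m.withDensity fun x => ‖v x‖ₑ ^ 2) := by
    rw [hμ, ← comp_trajSA_withDensity m (f := fun x => ‖v x‖ₑ ^ 2) (by fun_prop)]
    rfl
  obtain ⟨C, hC⟩ := hr2
  have hr : ∀ k, eLpNorm (fun ω => rew ω k) 2 (μ.withDensity fun ω => ‖u ω‖ₑ ^ 2) ≤ C := fun k => by
    rw [← eLpNorm_smul_eq_withDensity hum (measurable_rew k)]
    exact hC k
  have hb2' : MemLp (fun ω => b (st ω 0)) 2 (μ.withDensity fun ω => ‖u ω‖ₑ ^ 2) :=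
    (memLp_withDensity_iff hum (hb.comp (measurable_st 0))).2 hb2
  have hV2' : MemLp (fun ω => V (st ω 0)) 2 (μ.withDensity fun ω => ‖u ω‖ₑ ^ 2) :=
    (memLp_withDensity_iff hum (hVm.comp (measurable_st 0))).2 hV2
  rw [hμ'] at hr hb2' hV2'
  have core := second_moment_uae_sub_gae hγ₀ hγ₁ hlam₀ hlam₁ hQ hV hr hb hb2' hV2' hε hΨε
  simp only at core
  rw [← hμ'] at core
  obtain ⟨hae, hU2, hG2, hirr, hred, hmom, hdiff, hs2⟩ := core
  rw [ae_withDensity_enorm_sq_iff hum] at hae hdiff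
  have hUm := measurable_uae (γ := γ) (lam := lam) hΨm hb 0
  have hGm := measurable_gae (A := A) (γ := γ) (lam := lam) hVm 0
  rw [memLp_withDensity_iff hum hUm] at hU2
  rw [memLp_withDensity_iff hum hGm] at hG2
  rw [integrable_withDensity_enorm_sq_iff hum] at hirr hred
  simp only [integral_withDensity_enorm_sq hum] at hmom
  have hsq : ∀ X : Traj S A → ℝ, ∫ ω, ‖X ω • u ω‖ ^ 2 ∂μ = ∫ ω, ‖u ω‖ ^ 2 * X ω ^ 2 ∂μ :=
    fun X => integral_congr_ae (Filter.Eventually.of_forall fun ω => by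
      simp only [norm_smul, mul_pow, Real.norm_eq_abs, sq_abs, mul_comm])
  -- Means are taken under the unweighted law, where a_0 does follow π, so the score is centred
  -- given s_0.
  have hmean : ∫ ω, uae γ lam Ψ b 0 ω • u ω ∂μ = ∫ ω, gae γ lam V 0 ω • u ω ∂μ := by
    have hcu : Integrable (fun ω => (V (st ω 0) - b (st ω 0)) • u ω) μ := by
      have := (hV2.sub hb2).integrable (by norm_num)
      refine this.congr (Filter.Eventually.of_forall fun ω => ?_)
      simp only [Pi.sub_apply, sub_smul, V, u]
    have hcu0 : ∫ ω, (V (st ω 0) - b (st ω 0)) • u ω ∂μ = 0 := by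
      have hx : Measurable fun ω : Traj S A => (st ω 0, act ω 0) := by fun_prop
      have hgm : StronglyMeasurable fun x : S × A => (V x.1 - b x.1) • v x :=
        (((hVm.comp measurable_fst).sub (hb.comp measurable_fst)).smul hu).stronglyMeasurable
      have h1 : ∫ x, (V x.1 - b x.1) • v x ∂(μ.map fun ω => (st ω 0, act ω 0))
          = ∫ ω, (V (st ω 0) - b (st ω 0)) • u ω ∂μ :=
        integral_map hx.aemeasurable hgm.aestronglyMeasurable
      have h2 : Integrable (fun x : S × A => (V x.1 - b x.1) • v x)
          (μ.map fun ω => (st ω 0, act ω 0)) :=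
        (integrable_map_measure hgm.aestronglyMeasurable hx.aemeasurable).2 hcu
      rw [hμ, map_pair_zero] at h1 h2
      rw [hμ, ← h1, Measure.integral_compProd h2]
      simp only [integral_smul, v, Function.uncurry_apply_pair,
        PolicyFamily.integral_score hF hu, smul_zero, integral_zero]
    have hdiff1 := hdiff.mono fun ω h h0 => (h h0).1
    rw [hμ] at hs2 hdiff1
    obtain ⟨hM1, hM2⟩ := integral_tsum_adv_smul hV (v := v) hu hs2 hdiff1
    rw [← hμ] at hM1 hM2
    have h3 : (fun ω => uae γ lam Ψ b 0 ω • u ω) =ᵐ[μ] fun ω => gae γ lam V 0 ω • u ω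
        + ((V (st ω 0) - b (st ω 0)) • u ω + (γ * (1 - lam) * ε) •
          ((∑' l, (γ * lam) ^ l • adv P (F.kernel θ) γ (st ω (l + 1), act ω (l + 1)))
            • v (st ω 0, act ω 0))) := by
      filter_upwards [hdiff] with ω h
      -- The decomposition is known only where u ≠ 0; elsewhere both sides vanish.
      by_cases h0 : u ω = 0
      · have h0' : v (st ω 0, act ω 0) = 0 := h0
        simp [h0, h0']
      · rw [(h h0).2, add_smul, add_smul, mul_smul, add_assoc]
        rfl
    have hM3 := hM1.smul (γ * (1 - lam) * ε)
    simp only [Pi.smul_def] at hM3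
    have h4 := hcu.add hM3
    simp only [Pi.add_def] at h4
    rw [integral_congr_ae h3, integral_add (hG2.integrable (by norm_num)) h4,
      integral_add hcu hM3, integral_smul, hM2, hcu0]
    simp
  refine ⟨hae, hU2, hG2, hirr, hred, ?_⟩
  rw [vecVar_eq_sub hU2, vecVar_eq_sub hG2, hmean, hsq, hsq, sub_sub_sub_cancel_right]
  exact hmom

end UAE

end

/-! ### Transfer to an arbitrary time t -/

open UAE in
theorem mainTheorem1 {S A : Type*} [MeasurableSpace S] [MeasurableSpace A]
    -- the decision process: joint law of reward and next state, initial law, discount factor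
    (P : Kernel (S × A) (ℝ × S)) [IsMarkovKernel P]
    (ρ₀ : Measure S) [IsProbabilityMeasure ρ₀]
    (γ : ℝ) (hγ₀ : 0 ≤ γ) (hγ₁ : γ < 1)
    (lam : ℝ) (hlam₀ : 0 ≤ lam) (hlam₁ : lam ≤ 1)
    -- the parametrized policy and its score at `θ`
    {d : ℕ} (ν : Measure A) [SigmaFinite ν] (F : PolicyFamily d S ν)
    (θ : EuclideanSpace ℝ (Fin d)) (hF : F.RegularAt θ)
    (hu : Measurable (Function.uncurry (F.score θ)))
    -- the baseline
    (b : S → ℝ) (hb : Measurable b)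
    -- the true value functions are well defined
    (hQ : ∀ s a, ∫⁻ ω, absRet γ ω ∂(trajSA P (F.kernel θ) (s, a)) < ∞)
    (hV : ∀ s, ∫⁻ ω, absRet γ ω ∂(trajS P (F.kernel θ) s) < ∞)
    -- the bootstrapped function is one of them
    (Ψ : S → A → ℝ)
    (hΨ : Ψ = Qval P (F.kernel θ) γ ∨ Ψ = fun s _ => Vval P (F.kernel θ) γ s)
    (t : ℕ)
    -- finite second moments
    (hr2 : ∃ C : ℝ≥0, ∀ k, eLpNorm
      (fun ω => rew ω (t + k) • F.score θ (st ω t) (act ω t)) 2 (trajLaw P (F.kernel θ) ρ₀) ≤ C)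
    (hb2 : MemLp (fun ω => b (st ω t) • F.score θ (st ω t) (act ω t)) 2
      (trajLaw P (F.kernel θ) ρ₀))
    (hV2 : MemLp (fun ω => Vval P (F.kernel θ) γ (st ω t) • F.score θ (st ω t) (act ω t)) 2
      (trajLaw P (F.kernel θ) ρ₀)) :
    let μ : Measure (Traj S A) := trajLaw P (F.kernel θ) ρ₀
    let Q : S → A → ℝ := Qval P (F.kernel θ) γ
    let V : S → ℝ := Vval P (F.kernel θ) γ
    let u : Traj S A → EuclideanSpace ℝ (Fin d) := fun ω => F.score θ (st ω t) (act ω t)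
    -- `E[(Ψ - V)²]` at `(s_{t+l+1}, a_{t+l+1})`, given `s_t = s` and `a_t = a`
    let gap : S → A → ℕ → ℝ := fun s a l =>
      ∫ ω, (Ψ (st ω (l + 1)) (act ω (l + 1)) - V (st ω (l + 1))) ^ 2
        ∂(trajSA P (F.kernel θ) (s, a))
    let irred : Traj S A → ℝ := fun ω => ‖u ω‖ ^ 2 *
      ∑' l : ℕ, (γ * lam) ^ (2 * l) * (γ ^ 2 * (1 - lam ^ 2)) * gap (st ω t) (act ω t) l
    let red : Traj S A → ℝ := fun ω => ‖u ω‖ ^ 2 *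
      (b (st ω t) ^ 2 - V (st ω t) ^ 2
        - 2 * Q (st ω t) (act ω t) * (b (st ω t) - V (st ω t)))
    -- every series, variance and expectation in the formula is well defined
    (∀ᵐ ω ∂μ, u ω ≠ 0 →
      (Summable fun l => uaeTerm γ lam Ψ b t ω (l + 1)) ∧
      (Summable fun l => gaeTerm γ lam V t ω l) ∧
      (∀ l : ℕ, Integrable
        (fun ω' : Traj S A =>
          (Ψ (st ω' (l + 1)) (act ω' (l + 1)) - V (st ω' (l + 1))) ^ 2)
        (trajSA P (F.kernel θ) (st ω t, act ω t))) ∧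
      (Summable fun l : ℕ =>
        (γ * lam) ^ (2 * l) * (γ ^ 2 * (1 - lam ^ 2)) * gap (st ω t) (act ω t) l)) ∧
    MemLp (fun ω => uae γ lam Ψ b t ω • u ω) 2 μ ∧
    MemLp (fun ω => gae γ lam V t ω • u ω) 2 μ ∧
    Integrable irred μ ∧ Integrable red μ ∧
    -- the formula
    vecVar (fun ω => uae γ lam Ψ b t ω • u ω) μ - vecVar (fun ω => gae γ lam V t ω • u ω) μ
      = (∫ ω, irred ω ∂μ) + ∫ ω, red ω ∂μ := by
  intro μ Q V u gap irred red
  -- ρ is the law of s_t. Every quantity in the claim is a time-0 quantity evaluated at `restart t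
  -- ω`, so the result is pulled back along this map.
  obtain ⟨ρ, hρ, hmap⟩ := exists_trajLaw_map_restart (P := P) (π := F.kernel θ) ρ₀ t
  have hR : Measurable (restart t : Traj S A → Traj S A) := measurable_restart t
  have hVm : Measurable V := measurable_Vval P (F.kernel θ) γ
  have hΨm : Measurable (Function.uncurry Ψ) := by
    rcases hΨ with rfl | rfl
    · exact measurable_Qval P (F.kernel θ) γ
    · exact hVm.comp measurable_fst
  have hum : Measurable fun ω : Traj S A => F.score θ (st ω 0) (act ω 0) :=
    hu.comp ((measurable_st 0).prodMk (measurable_act 0))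
  have hsm : ∀ {X : Traj S A → ℝ}, Measurable X →
      Measurable fun ω => X ω • F.score θ (st ω 0) (act ω 0) := fun hX => hX.smul hum
  have hmemLp : ∀ {X : Traj S A → ℝ}, Measurable X →
      (MemLp (fun ω => X ω • F.score θ (st ω 0) (act ω 0)) 2 (trajLaw P (F.kernel θ) ρ) ↔
        MemLp (fun ω => X (restart t ω) • u ω) 2 μ) := fun {X} hX => by
    rw [← hmap, memLp_map_measure_iff (hsm hX).aestronglyMeasurable hR.aemeasurable]
    rfl
  have hvar : ∀ {X : Traj S A → ℝ}, Measurable X →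
      vecVar (fun ω => X ω • F.score θ (st ω 0) (act ω 0)) (trajLaw P (F.kernel θ) ρ)
        = vecVar (fun ω => X (restart t ω) • u ω) μ := fun {X} hX => by
    have hm := hsm hX
    have h1 : ∫ ω, X ω • F.score θ (st ω 0) (act ω 0) ∂(trajLaw P (F.kernel θ) ρ)
        = ∫ ω, X (restart t ω) • u ω ∂μ := by
      rw [← hmap, integral_map hR.aemeasurable hm.aestronglyMeasurable]
      rfl
    rw [vecVar, vecVar, h1, ← hmap, integral_map hR.aemeasurable
      ((hm.sub_const _).norm.pow_const 2).aestronglyMeasurable]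
    rfl
  have key := variance_uae_sub_gae_zero P ρ γ hγ₀ hγ₁ lam hlam₀ hlam₁ ν F θ hF hu b hb hQ hV Ψ hΨ
    (hr2.imp fun C hC k => by
      rw [← hmap, eLpNorm_map_measure (hsm (measurable_rew k)).aestronglyMeasurable
        hR.aemeasurable]
      simpa [Function.comp_def] using hC k)
    ((hmemLp (hb.comp (measurable_st 0))).2 hb2)
    ((hmemLp (hVm.comp (measurable_st 0))).2 hV2)
  simp only at key
  obtain ⟨h1, h2, h3, h4, h5, h6⟩ := key
  have hUm := measurable_uae (γ := γ) (lam := lam) hΨm hb 0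
  have hGm := measurable_gae (A := A) (γ := γ) (lam := lam) hVm 0
  rw [hvar hUm, hvar hGm] at h6
  rw [hmemLp hUm] at h2
  rw [hmemLp hGm] at h3
  rw [← hmap] at h1 h4 h5 h6
  rw [integral_map hR.aemeasurable h4.1, integral_map hR.aemeasurable h5.1] at h6
  have h1' := ae_of_ae_map hR.aemeasurable h1
  have h4' := (integrable_map_measure h4.1 hR.aemeasurable).1 h4
  have h5' := (integrable_map_measure h5.1 hR.aemeasurable).1 h5
  simp only [uae_restart, gae_restart, uaeTerm_restart, gaeTerm_restart, st_restart, act_restart,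
    add_zero] at h1' h2 h3 h6
  exact ⟨h1', h2, h3, h4', h5', h6⟩
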